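/- Let $R=\bigoplus_{n\ge 0}R_n$ be a standard graded commutative Noetherian ring, i.e. $R_0$ is Noetherian and $R$ is generated as an $R_0$-algebra by finitely many elements of $R_1$. Assume that $R_0$ is local with infinite residue field, and put $R_+=\bigoplus_{n\ge 1}R_n$. Let $J$ be a homogeneous ideal of $R$. For a $\mathbb Z$-graded $R$-module $N$ let $$\Gamma_{R_+,J}(N)=\{x\in N : (R_+)^n x\subseteq Jx \text{ for all } n\gg 0\},$$ and let $H^k_{R_+,J}$ denote the $k$-th right derived functor of $\Gamma_{R_+,J}$ on the category of $\mathbb Z$-graded $R$-modules and degree-preserving homomorphisms, so that $H^k_{R_+,J}(N)$ is a $\mathbb Z$-graded $R$-module, with components $H^k_{R_+,J}(N)_n$ that are $R_0$-modules. Let $M$ be a finitely generated $\mathbb Z$-graded $R$-module and let $i\ge 0$ be an integer such that $H^j_{R_+,J}(M)$ is a finitely generated $R$-module for all $j<i$. Suppose that one of the following two conditions holds: (a) for every finitely generated graded $R$-module $N$ and every $k\ge 0$, $H^k_{R_+,J}(N)_n=0$ for all $n\gg 0$; (b) for every finitely generated graded $R$-module $N$, every $k\ge 0$ and every $n\in\mathbb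 Z$, $H^k_{R_+,J}(N)_n$ is a finitely generated $R_0$-module. Then $\mathrm{Ass}_{R_0}\bigl(H^i_{R_+,J}(M)_n\bigr)$ is asymptotically stable as $n\to-\infty$, i.e. there is $n_0\in\mathbb Z$ such that $\mathrm{Ass}_{R_0}\bigl(H^i_{R_+,J}(M)_n\bigr)=\mathrm{Ass}_{R_0}\bigl(H^i_{R_+,J}(M)_{n_0}\bigr)$ for all $n\le n_0$. -/

import Mathlib

universe u

namespace GradedLC

open CategoryTheory CategoryTheory.Limits

section GradedModules

variable {R₀ R : Type u} [CommRing R₀] [CommRing R] [Algebra R₀ R]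

/-- A `ℤ`-graded module over the `ℕ`-graded `R₀`-algebra `R = ⨁ 𝒜 m`. -/
structure GrMod (𝒜 : ℕ → Submodule R₀ R) where
  carrier : Type u
  [addCommGroup : AddCommGroup carrier]
  [module : Module R carrier]
  [moduleZero : Module R₀ carrier]
  [isScalarTower : IsScalarTower R₀ R carrier]
  deg : ℤ → Submodule R₀ carrier
  isInternal : DirectSum.IsInternal deg
  smul_mem : ∀ {m : ℕ} {n : ℤ} {a : R} {x : carrier},
    a ∈ 𝒜 m → x ∈ deg n → a • x ∈ deg (m + n)

attribute [instance] GrMod.addCommGroup GrMod.module GrMod.moduleZero GrMod.isScalarTower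

variable {𝒜 : ℕ → Submodule R₀ R}

namespace GrMod

instance : CoeSort (GrMod 𝒜) (Type u) := ⟨GrMod.carrier⟩

/-- Morphisms of graded modules: `R`-linear maps that preserve degrees. -/
@[ext]
structure Hom (X Y : GrMod 𝒜) where
  toLin : X →ₗ[R] Y
  map_deg : ∀ {n : ℤ} {x : X}, x ∈ X.deg n → toLin x ∈ Y.deg n

instance : Category (GrMod 𝒜) where
  Hom X Y := Hom X Y
  id X := ⟨LinearMap.id, fun h => h⟩
  comp f g := ⟨g.toLin ∘ₗ f.toLin, fun h => g.map_deg (f.map_deg h)⟩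

variable {X Y Z : GrMod 𝒜}

@[ext]
lemma hom_ext {f g : X ⟶ Y} (h : ∀ x, f.toLin x = g.toLin x) : f = g :=
  Hom.ext (LinearMap.ext h)

@[simp] lemma id_toLin : Hom.toLin (𝟙 X) = LinearMap.id := rfl

@[simp] lemma comp_toLin (f : X ⟶ Y) (g : Y ⟶ Z) :
    (f ≫ g).toLin = g.toLin ∘ₗ f.toLin := rfl

instance : Zero (X ⟶ Y) := ⟨⟨0, fun _ => by simp⟩⟩
instance : Add (X ⟶ Y) :=
  ⟨fun f g => ⟨f.toLin + g.toLin, fun h => add_mem (f.map_deg h) (g.map_deg h)⟩⟩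
instance : Neg (X ⟶ Y) := ⟨fun f => ⟨-f.toLin, fun h => neg_mem (f.map_deg h)⟩⟩
instance : Sub (X ⟶ Y) :=
  ⟨fun f g => ⟨f.toLin - g.toLin, fun h => sub_mem (f.map_deg h) (g.map_deg h)⟩⟩
instance : SMul ℕ (X ⟶ Y) :=
  ⟨fun n f => ⟨n • f.toLin, fun h => nsmul_mem (f.map_deg h) n⟩⟩
instance : SMul ℤ (X ⟶ Y) :=
  ⟨fun n f => ⟨n • f.toLin, fun h => zsmul_mem (f.map_deg h) n⟩⟩

@[simp] lemma zero_toLin : (0 : X ⟶ Y).toLin = 0 := rfl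
@[simp] lemma add_toLin (f g : X ⟶ Y) : (f + g).toLin = f.toLin + g.toLin := rfl

lemma toLin_injective : Function.Injective (fun f : X ⟶ Y => f.toLin) :=
  fun _ _ h => Hom.ext h

instance : AddCommGroup (X ⟶ Y) :=
  toLin_injective.addCommGroup _ rfl (fun _ _ => rfl) (fun _ => rfl) (fun _ _ => rfl)
    (fun _ _ => rfl) (fun _ _ => rfl)

instance : Preadditive (GrMod 𝒜) where
  add_comp _ _ _ f f' g := by ext x; simp
  comp_add _ _ _ f g g' := by ext x; simp

section Internal

variable {C : Type u} [AddCommGroup C] [Module R₀ C]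

/-- Recognise an internal direct sum through its projections. -/
lemma isInternal_of_proj (D : ℤ → Submodule R₀ C) (p : ℤ → C →ₗ[R₀] C)
    (hp : ∀ n, ∀ x ∈ D n, p n x = x) (hp' : ∀ m n, m ≠ n → ∀ x ∈ D m, p n x = 0)
    (htop : ∀ x : C, x ∈ ⨆ n, D n) : DirectSum.IsInternal D := by
  classical
  rw [DirectSum.isInternal_submodule_iff_iSupIndep_and_iSup_eq_top]
  refine ⟨?_, eq_top_iff.2 fun x _ => htop x⟩
  rw [iSupIndep_def]
  intro n
  rw [Submodule.disjoint_def]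
  intro x hx hx'
  have h0 : (⨆ j, ⨆ (_ : j ≠ n), D j) ≤ LinearMap.ker (p n) :=
    iSup₂_le fun j hj y hy => hp' j n hj y hy
  rw [← hp n x hx]
  exact h0 hx'

end Internal

/-- The homogeneous component of degree `n`. -/
noncomputable def proj (X : GrMod 𝒜) (n : ℤ) : X →ₗ[R₀] X :=
  (X.deg n).subtype ∘ₗ DirectSum.component R₀ ℤ (fun n => X.deg n) n ∘ₗ
    (LinearEquiv.ofBijective (DirectSum.coeLinearMap X.deg) X.isInternal).symm.toLinearMap

lemma proj_mem (X : GrMod 𝒜) (n : ℤ) (x : X) : X.proj n x ∈ X.deg n :=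
  Submodule.coe_mem _

lemma proj_same (X : GrMod 𝒜) {n : ℤ} {x : X} (hx : x ∈ X.deg n) : X.proj n x = x :=
  congrArg Subtype.val (X.isInternal.ofBijective_coeLinearMap_of_mem hx)

lemma proj_ne (X : GrMod 𝒜) {m n : ℤ} (h : m ≠ n) {x : X} (hx : x ∈ X.deg m) :
    X.proj n x = 0 :=
  congrArg Subtype.val (X.isInternal.ofBijective_coeLinearMap_of_mem_ne h hx)

lemma mem_iSup_deg (X : GrMod 𝒜) (x : X) : x ∈ ⨆ n, X.deg n := by
  rw [X.isInternal.submodule_iSup_eq_top]; trivial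

/-- Every element is the sum of its homogeneous components. -/
lemma exists_eq_sum (X : GrMod 𝒜) (x : X) : ∃ s : Finset ℤ, x = ∑ n ∈ s, X.proj n x ∧
    ∀ n ∉ s, X.proj n x = 0 := by
  classical
  refine Submodule.iSup_induction (motive := fun x => ∃ s : Finset ℤ, x = ∑ n ∈ s, X.proj n x ∧
    ∀ n ∉ s, X.proj n x = 0) _ (X.mem_iSup_deg x) ?_ ?_ ?_
  · intro i x hx
    refine ⟨{i}, by simp [X.proj_same hx], fun n hn => X.proj_ne (fun h => ?_) hx⟩
    simp [h] at hn
  · exact ⟨∅, by simp, by simp⟩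
  · rintro x y ⟨s, hs, hs'⟩ ⟨t, ht, ht'⟩
    refine ⟨s ∪ t, ?_, fun n hn => ?_⟩
    · have h1 : ∑ n ∈ s ∪ t, X.proj n x = x :=
        (Finset.sum_subset Finset.subset_union_left fun n _ hn => hs' n hn).symm.trans hs.symm
      have h2 : ∑ n ∈ s ∪ t, X.proj n y = y :=
        (Finset.sum_subset Finset.subset_union_right fun n _ hn => ht' n hn).symm.trans ht.symm
      simp only [map_add, Finset.sum_add_distrib, h1, h2]
    · simp only [Finset.mem_union, not_or] at hn
      simp [hs' n hn.1, ht' n hn.2]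

lemma eq_of_proj_eq (X : GrMod 𝒜) {x y : X} (h : ∀ n, X.proj n x = X.proj n y) : x = y := by
  obtain ⟨s, hs, -⟩ := X.exists_eq_sum (x - y)
  rw [← sub_eq_zero, hs]
  exact Finset.sum_eq_zero fun n _ => by simp [h n]

/-- The underlying `R`-linear map of a morphism is `R₀`-linear. -/
def Hom.toLin₀ (f : Hom X Y) : X →ₗ[R₀] Y := f.toLin.restrictScalars R₀

@[simp] lemma Hom.toLin₀_apply (f : Hom X Y) (x : X) : f.toLin₀ x = f.toLin x := rfl

lemma Hom.map_proj (f : Hom X Y) (n : ℤ) (x : X) : f.toLin (X.proj n x) = Y.proj n (f.toLin x) := by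
  refine Submodule.iSup_induction (motive := fun x => f.toLin (X.proj n x) = Y.proj n (f.toLin x))
    _ (X.mem_iSup_deg x) ?_ (by simp) (fun x y hx hy => by simp [hx, hy])
  intro m x hx
  by_cases h : m = n
  · subst h
    rw [X.proj_same hx, Y.proj_same (f.map_deg hx)]
  · rw [X.proj_ne h hx, Y.proj_ne h (f.map_deg hx), map_zero]

/-- A homogeneous submodule, as a graded module. -/
noncomputable def sub (X : GrMod 𝒜) (N : Submodule R X) (hN : ∀ x ∈ N, ∀ n, X.proj n x ∈ N) :
    GrMod 𝒜 where
  carrier := N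
  deg n := (X.deg n).comap (N.subtype.restrictScalars R₀)
  isInternal := by
    refine isInternal_of_proj _
      (fun n => ((X.proj n).restrict (p := N.restrictScalars R₀) (q := N.restrictScalars R₀)
        fun x hx => hN x hx n))
      (fun n x hx => Subtype.ext (X.proj_same hx))
      (fun m n h x hx => Subtype.ext (X.proj_ne h hx)) ?_
    intro x
    obtain ⟨s, hs, -⟩ := X.exists_eq_sum (x : X)
    have : x = ∑ n ∈ s, (⟨X.proj n x, hN x x.2 n⟩ : N) := Subtype.ext (by simpa using hs)
    rw [this]
    exact Submodule.sum_mem _ fun n _ => Submodule.mem_iSup_of_mem n (X.proj_mem n _)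
  smul_mem ha hx := X.smul_mem ha hx

/-- The inclusion of a homogeneous submodule. -/
noncomputable def subι (X : GrMod 𝒜) (N : Submodule R X) (hN : ∀ x ∈ N, ∀ n, X.proj n x ∈ N) :
    X.sub N hN ⟶ X :=
  ⟨N.subtype, fun h => h⟩

/-- The quotient by a homogeneous submodule, as a graded module. -/
noncomputable def quot (X : GrMod 𝒜) (N : Submodule R X) (hN : ∀ x ∈ N, ∀ n, X.proj n x ∈ N) :
    GrMod 𝒜 where
  carrier := X ⧸ N
  deg n := (X.deg n).map (N.mkQ.restrictScalars R₀)
  isInternal := by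
    refine isInternal_of_proj _
      (fun n => ((N.restrictScalars R₀).mapQ (N.restrictScalars R₀) (X.proj n)
        fun x hx => hN x hx n)) ?_ ?_ ?_
    · rintro n _ ⟨x, hx, rfl⟩
      exact congrArg N.mkQ (X.proj_same hx)
    · rintro m n h _ ⟨x, hx, rfl⟩
      exact (congrArg N.mkQ (X.proj_ne h hx)).trans (map_zero _)
    · intro y
      obtain ⟨x, rfl⟩ := N.mkQ_surjective y
      obtain ⟨s, hs, -⟩ := X.exists_eq_sum x
      rw [hs, map_sum]
      exact Submodule.sum_mem _ fun n _ => Submodule.mem_iSup_of_mem n ⟨_, X.proj_mem n _, rfl⟩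
  smul_mem := by
    rintro m n a _ ha ⟨x, hx, rfl⟩
    exact ⟨a • x, X.smul_mem ha hx, rfl⟩

/-- The projection onto the quotient by a homogeneous submodule. -/
noncomputable def quotπ (X : GrMod 𝒜) (N : Submodule R X) (hN : ∀ x ∈ N, ∀ n, X.proj n x ∈ N) :
    X ⟶ X.quot N hN :=
  ⟨N.mkQ, fun h => ⟨_, h, rfl⟩⟩

/-- The direct sum of two graded modules. -/
def prod (X Y : GrMod 𝒜) : GrMod 𝒜 where
  carrier := X × Y
  deg n := (X.deg n).prod (Y.deg n)
  isInternal := by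
    refine isInternal_of_proj _ (fun n => (X.proj n).prodMap (Y.proj n))
      (fun n x hx => Prod.ext (X.proj_same hx.1) (Y.proj_same hx.2))
      (fun m n h x hx => Prod.ext (X.proj_ne h hx.1) (Y.proj_ne h hx.2)) ?_
    rintro ⟨x, y⟩
    obtain ⟨s, hs, -⟩ := X.exists_eq_sum x
    obtain ⟨t, ht, -⟩ := Y.exists_eq_sum y
    have : (x, y) = (∑ n ∈ s, (X.proj n x, (0 : Y))) + ∑ n ∈ t, ((0 : X), Y.proj n y) := by
      refine Prod.ext ?_ ?_
      · simpa [Prod.fst_sum] using hs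
      · simpa [Prod.snd_sum] using ht
    rw [this]
    exact add_mem
      (Submodule.sum_mem _ fun n _ => Submodule.mem_iSup_of_mem n ⟨X.proj_mem n _, zero_mem _⟩)
      (Submodule.sum_mem _ fun n _ => Submodule.mem_iSup_of_mem n ⟨zero_mem _, Y.proj_mem n _⟩)
  smul_mem ha hx := ⟨X.smul_mem ha hx.1, Y.smul_mem ha hx.2⟩

/-- The zero graded module. -/
def zero : GrMod 𝒜 where
  carrier := PUnit
  deg _ := ⊤
  isInternal := isInternal_of_proj _ (fun _ => 0) (fun _ _ _ => rfl) (fun _ _ _ _ _ => rfl)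
    (fun _ => Submodule.mem_iSup_of_mem 0 trivial)
  smul_mem _ _ := trivial

instance : HasZeroObject (GrMod 𝒜) where
  zero := ⟨zero, ⟨fun Y => ⟨⟨⟨0⟩, fun f => by
      ext x; exact (congrArg f.toLin (Subsingleton.elim (α := PUnit) x 0)).trans (map_zero _)⟩⟩,
    fun Y => ⟨⟨⟨0⟩, fun _ => by ext; exact Subsingleton.elim (α := PUnit) _ _⟩⟩⟩⟩

instance : HasBinaryBiproducts (GrMod 𝒜) where
  has_binary_biproduct X Y := hasBinaryBiproduct_of_total
    { pt := X.prod Y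
      fst := ⟨LinearMap.fst R X Y, fun h => h.1⟩
      snd := ⟨LinearMap.snd R X Y, fun h => h.2⟩
      inl := ⟨LinearMap.inl R X Y, fun h => ⟨h, zero_mem _⟩⟩
      inr := ⟨LinearMap.inr R X Y, fun h => ⟨zero_mem _, h⟩⟩
      inl_fst := rfl
      inl_snd := rfl
      inr_fst := rfl
      inr_snd := rfl } (by ext x; exact Prod.ext (add_zero _) (zero_add _))

lemma ker_homogeneous (f : X ⟶ Y) : ∀ x ∈ LinearMap.ker f.toLin, ∀ n,
    X.proj n x ∈ LinearMap.ker f.toLin := by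
  intro x hx n
  rw [LinearMap.mem_ker] at hx ⊢
  rw [Hom.map_proj, hx, map_zero]

lemma range_homogeneous (f : X ⟶ Y) : ∀ y ∈ LinearMap.range f.toLin, ∀ n,
    Y.proj n y ∈ LinearMap.range f.toLin := by
  rintro _ ⟨x, rfl⟩ n
  exact ⟨X.proj n x, Hom.map_proj f n x⟩

/-- The inclusion of the kernel is a kernel. -/
noncomputable def kernelIsLimit (f : X ⟶ Y) :
    IsLimit (KernelFork.ofι (f := f) (X.subι _ (ker_homogeneous f))
      (by ext x; exact x.2)) :=
  KernelFork.IsLimit.ofι _ _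
    (fun {W} g hg => ⟨g.toLin.codRestrict _ fun w =>
      congrArg (fun k : W ⟶ Y => k.toLin w) hg, fun h => g.map_deg h⟩)
    (fun _ _ => rfl)
    (fun {W} g hg k hk => by
      ext w
      exact Subtype.ext (congrArg (fun k : W ⟶ X => k.toLin w) hk))

/-- The projection to the quotient by the image is a cokernel. -/
noncomputable def cokernelIsColimit (f : X ⟶ Y) :
    IsColimit (CokernelCofork.ofπ (f := f) (Y.quotπ _ (range_homogeneous f))
      (by ext x; exact (Submodule.Quotient.mk_eq_zero _).2 ⟨x, rfl⟩)) :=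
  CokernelCofork.IsColimit.ofπ _ _
    (fun {W} g hg => ⟨Submodule.liftQ _ g.toLin (by
      rintro _ ⟨x, rfl⟩
      exact congrArg (fun k : X ⟶ W => k.toLin x) hg), by
      rintro n _ ⟨y, hy, rfl⟩
      exact g.map_deg hy⟩)
    (fun _ _ => rfl)
    (fun {W} g hg k hk => by
      ext w
      obtain ⟨y, rfl⟩ := Submodule.mkQ_surjective _ w
      exact congrArg (fun k : Y ⟶ W => k.toLin y) hk)

instance : HasKernels (GrMod 𝒜) := ⟨fun f => ⟨⟨_, kernelIsLimit f⟩⟩⟩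

instance : HasCokernels (GrMod 𝒜) := ⟨fun f => ⟨⟨_, cokernelIsColimit f⟩⟩⟩

lemma injective_of_mono (f : X ⟶ Y) [Mono f] : Function.Injective f.toLin := by
  rw [← LinearMap.ker_eq_bot]
  have h : X.subι _ (ker_homogeneous f) = 0 := by
    rw [← cancel_mono f]
    ext x
    exact x.2.trans (by simp)
  rw [eq_bot_iff]
  intro x hx
  exact congrArg (fun k : X.sub _ (ker_homogeneous f) ⟶ X => k.toLin ⟨x, hx⟩) h

lemma mono_of_injective (f : X ⟶ Y) (h : Function.Injective f.toLin) : Mono f :=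
  ⟨fun {W} g k hgk => by
    ext w; exact h (congrArg (fun k : W ⟶ Y => k.toLin w) hgk)⟩

lemma surjective_of_epi (f : X ⟶ Y) [Epi f] : Function.Surjective f.toLin := by
  rw [← LinearMap.range_eq_top]
  have h : Y.quotπ _ (range_homogeneous f) = 0 := by
    rw [← cancel_epi f]
    ext x
    exact (Submodule.Quotient.mk_eq_zero _).2 ⟨x, rfl⟩
  rw [eq_top_iff]
  intro y _
  exact (Submodule.Quotient.mk_eq_zero _).1
    (congrArg (fun k : Y ⟶ Y.quot _ (range_homogeneous f) => k.toLin y) h)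

lemma mem_deg_of_injective (f : X ⟶ Y) (h : Function.Injective f.toLin) {n : ℤ} {x : X}
    (hx : f.toLin x ∈ Y.deg n) : x ∈ X.deg n := by
  have : X.proj n x = x := h (by rw [Hom.map_proj, Y.proj_same hx])
  rw [← this]
  exact X.proj_mem n x

lemma exists_mem_deg_of_surjective (f : X ⟶ Y) (h : Function.Surjective f.toLin) {n : ℤ} {y : Y}
    (hy : y ∈ Y.deg n) : ∃ x ∈ X.deg n, f.toLin x = y := by
  obtain ⟨x, rfl⟩ := h y
  exact ⟨X.proj n x, X.proj_mem n x, by rw [Hom.map_proj, Y.proj_same hy]⟩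

/-- The factorisation of a morphism that vanishes in the cokernel of a monomorphism `f`. -/
noncomputable def preimage {W : GrMod 𝒜} (f : X ⟶ Y) [Mono f] (g : W ⟶ Y)
    (hg : g ≫ Y.quotπ _ (range_homogeneous f) = 0) : W →ₗ[R] X :=
  (LinearEquiv.ofInjective f.toLin (injective_of_mono f)).symm.toLinearMap ∘ₗ
    g.toLin.codRestrict (LinearMap.range f.toLin) fun w =>
      (Submodule.Quotient.mk_eq_zero _).1
        (congrArg (fun k : W ⟶ Y.quot _ (range_homogeneous f) => k.toLin w) hg)

lemma preimage_spec {W : GrMod 𝒜} (f : X ⟶ Y) [Mono f] (g : W ⟶ Y)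
    (hg : g ≫ Y.quotπ _ (range_homogeneous f) = 0) (w : W) :
    f.toLin (preimage f g hg w) = g.toLin w :=
  congrArg Subtype.val ((LinearEquiv.ofInjective f.toLin (injective_of_mono f)).apply_symm_apply _)

/-- A monomorphism is the kernel of its cokernel. -/
lemma normalMono (f : X ⟶ Y) [Mono f] : Nonempty (NormalMono f) := ⟨{
  Z := Y.quot _ (range_homogeneous f)
  g := Y.quotπ _ (range_homogeneous f)
  w := by ext x; exact (Submodule.Quotient.mk_eq_zero _).2 ⟨x, rfl⟩
  isLimit := KernelFork.IsLimit.ofι _ _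
    (fun {W} g hg => ⟨preimage f g hg, fun {n w} h =>
      mem_deg_of_injective f (injective_of_mono f) (by
        rw [preimage_spec]; exact g.map_deg h)⟩)
    (fun {W} g hg => by ext w; exact preimage_spec f g hg w)
    (fun {W} g hg k hk => by
      rw [← cancel_mono f, hk]
      ext w; exact (preimage_spec f g hg w).symm) }⟩

/-- An epimorphism is the cokernel of its kernel. -/
lemma normalEpi (f : X ⟶ Y) [Epi f] : Nonempty (NormalEpi f) := ⟨{
  W := X.sub _ (ker_homogeneous f)
  g := X.subι _ (ker_homogeneous f)
  w := by ext x; exact x.2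
  isColimit := CokernelCofork.IsColimit.ofπ _ _
    (fun {W} g hg => ⟨(Submodule.liftQ (LinearMap.ker f.toLin) g.toLin fun x hx =>
        congrArg (fun k : X.sub _ (ker_homogeneous f) ⟶ W => k.toLin ⟨x, hx⟩) hg) ∘ₗ
        (f.toLin.quotKerEquivOfSurjective (surjective_of_epi f)).symm.toLinearMap,
      fun {n y} h => by
        obtain ⟨x, hx, rfl⟩ := exists_mem_deg_of_surjective f (surjective_of_epi f) h
        have : (f.toLin.quotKerEquivOfSurjective (surjective_of_epi f)).symm (f.toLin x) =
          Submodule.Quotient.mk x := by rw [LinearEquiv.symm_apply_eq]; rfl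
        simp only [LinearMap.comp_apply, LinearEquiv.coe_coe, this]
        exact g.map_deg hx⟩)
    (fun {W} g hg => by
      ext x
      have : (f.toLin.quotKerEquivOfSurjective (surjective_of_epi f)).symm (f.toLin x) =
          Submodule.Quotient.mk x := by rw [LinearEquiv.symm_apply_eq]; rfl
      simp only [comp_toLin, LinearMap.comp_apply, LinearEquiv.coe_coe, this]
      rfl)
    (fun {W} g hg k hk => by
      rw [← cancel_epi f, hk]
      ext x
      have : (f.toLin.quotKerEquivOfSurjective (surjective_of_epi f)).symm (f.toLin x) =
          Submodule.Quotient.mk x := by rw [LinearEquiv.symm_apply_eq]; rfl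
      simp only [comp_toLin, LinearMap.comp_apply, LinearEquiv.coe_coe, this]
      rfl) }⟩

noncomputable instance : Abelian (GrMod 𝒜) where
  normalMonoOfMono f _ := normalMono f
  normalEpiOfEpi f _ := normalEpi f
  has_finite_products := by
    have := hasBinaryProducts_of_hasBinaryBiproducts (C := GrMod 𝒜)
    exact hasFiniteProducts_of_has_binary_and_terminal

section Cofree

open DirectSum

/-- The underlying group of the graded module `⨁_{n ∈ ℤ} N`, in which a homogeneous `a` of degree
`m` sends `x` in degree `n` to `a • x` in degree `m + n`. -/
def Cofree (_ : ℕ → Submodule R₀ R) (N : Type u) [AddCommGroup N] : Type u := ℤ →₀ N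

namespace Cofree

section

variable (𝒜) (N : Type u) [AddCommGroup N] [Module R₀ N]

noncomputable instance : AddCommGroup (Cofree 𝒜 N) := inferInstanceAs (AddCommGroup (ℤ →₀ N))

noncomputable instance : Module R₀ (Cofree 𝒜 N) := inferInstanceAs (Module R₀ (ℤ →₀ N))

/-- `x` placed in degree `n`. -/
noncomputable def single (n : ℤ) : N →ₗ[R₀] Cofree 𝒜 N := Finsupp.lsingle (R := R₀) n

/-- The linear map determined by linear maps in each degree. -/
noncomputable def lift {P : Type u} [AddCommGroup P] [Module R₀ P] (f : ℤ → N →ₗ[R₀] P) :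
    Cofree 𝒜 N →ₗ[R₀] P := Finsupp.lsum R₀ f

@[simp]
lemma lift_single {P : Type u} [AddCommGroup P] [Module R₀ P] (f : ℤ → N →ₗ[R₀] P) (n : ℤ)
    (x : N) : lift 𝒜 N f (single 𝒜 N n x) = f n x :=
  Finsupp.lsum_single R₀ f n x

variable {𝒜 N} in
lemma lhom_ext {P : Type u} [AddCommGroup P] [Module R₀ P] {f g : Cofree 𝒜 N →ₗ[R₀] P}
    (h : ∀ n x, f (single 𝒜 N n x) = g (single 𝒜 N n x)) : f = g :=
  Finsupp.lhom_ext (M := N) h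

end

variable (𝒜) (N : Type u) [AddCommGroup N] [Module R N] [Module R₀ N] [IsScalarTower R₀ R N]

/-- The action of the homogeneous elements of degree `m`. -/
noncomputable def actHom (m : ℕ) : 𝒜 m →ₗ[R₀] Module.End R₀ (Cofree 𝒜 N) where
  toFun a := lift 𝒜 N fun n : ℤ =>
    single 𝒜 N (m + n) ∘ₗ (Algebra.lsmul R₀ R₀ N (a : R) : N →ₗ[R₀] N)
  map_add' a b := by
    refine lhom_ext fun n x => ?_
    rw [LinearMap.add_apply, lift_single, lift_single, lift_single]
    simp
  map_smul' a b := by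
    refine lhom_ext fun n x => ?_
    rw [LinearMap.smul_apply, lift_single, lift_single]
    simp

lemma actHom_single (m : ℕ) (a : 𝒜 m) (n : ℤ) (x : N) :
    actHom 𝒜 N m a (single 𝒜 N n x) = single 𝒜 N (m + n) ((a : R) • x) :=
  lift_single 𝒜 N _ n x

variable [GradedAlgebra 𝒜]

/-- The action of `⨁ 𝒜 m`. -/
noncomputable def actSum : (⨁ m, 𝒜 m) →ₐ[R₀] Module.End R₀ (Cofree 𝒜 N) :=
  DirectSum.toAlgebra R₀ (fun m => 𝒜 m) (actHom 𝒜 N)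
    (by
      refine lhom_ext fun n x => ?_
      rw [actHom_single]
      simp)
    (by
      intro i j a b
      refine lhom_ext fun n x => ?_
      rw [Module.End.mul_apply, actHom_single, actHom_single, actHom_single]
      simp [mul_smul, add_assoc])

/-- The action of `R`. -/
noncomputable def act : R →ₐ[R₀] Module.End R₀ (Cofree 𝒜 N) :=
  (actSum 𝒜 N).comp (DirectSum.decomposeAlgEquiv 𝒜 : R →ₐ[R₀] ⨁ m, 𝒜 m)

lemma act_single {m : ℕ} {a : R} (ha : a ∈ 𝒜 m) (n : ℤ) (x : N) :
    act 𝒜 N a (single 𝒜 N n x) = single 𝒜 N (m + n) (a • x) := by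
  rw [← actHom_single 𝒜 N m ⟨a, ha⟩]
  have : act 𝒜 N a = actHom 𝒜 N m ⟨a, ha⟩ := by
    change actSum 𝒜 N (DirectSum.decompose 𝒜 a) = _
    rw [DirectSum.decompose_of_mem _ ha]
    rw [actSum, DirectSum.toAlgebra_apply]
    exact DirectSum.toAddMonoid_of (fun m => (actHom 𝒜 N m).toAddMonoidHom) m ⟨a, ha⟩
  rw [this]

noncomputable instance : Module R (Cofree 𝒜 N) :=
  Module.compHom _ (act 𝒜 N).toRingHom

lemma smul_single {m : ℕ} {a : R} (ha : a ∈ 𝒜 m) (n : ℤ) (x : N) :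
    a • single 𝒜 N n x = single 𝒜 N (m + n) (a • x) :=
  act_single 𝒜 N ha n x

instance : IsScalarTower R₀ R (Cofree 𝒜 N) where
  smul_assoc r a x := by
    change act 𝒜 N (r • a) x = r • act 𝒜 N a x
    rw [map_smul]; rfl

/-- A degreewise criterion for the `R`-linearity of a map. -/
lemma map_smul_of_homogeneous {𝒜 : ℕ → Submodule R₀ R} [GradedAlgebra 𝒜] {P Q : Type u}
    [AddCommGroup P] [Module R P] [AddCommGroup Q] [Module R Q] (f : P →+ Q)
    (h : ∀ (m : ℕ) (a : R), a ∈ 𝒜 m → ∀ x, f (a • x) = a • f x) (a : R) (x : P) :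
    f (a • x) = a • f x := by
  induction a using DirectSum.Decomposition.inductionOn 𝒜 with
  | zero => simp
  | @homogeneous m a => exact h m a a.2 x
  | add a b ha hb => rw [add_smul, map_add, ha, hb, add_smul]

/-- The summation map `⨁_{n ∈ ℤ} N → N`. -/
noncomputable def sum : Cofree 𝒜 N →ₗ[R] N :=
  { lift 𝒜 N fun _ : ℤ => LinearMap.id (R := R₀) (M := N) with
    map_smul' := map_smul_of_homogeneous (𝒜 := 𝒜)
      (lift 𝒜 N fun _ : ℤ => LinearMap.id (R := R₀) (M := N)).toAddMonoidHom fun m a ha x => by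
        have h : lift 𝒜 N (fun _ : ℤ => LinearMap.id (R := R₀) (M := N)) ∘ₗ
            Algebra.lsmul R₀ R₀ (Cofree 𝒜 N) a =
          Algebra.lsmul R₀ R₀ N a ∘ₗ lift 𝒜 N (fun _ : ℤ => LinearMap.id (R := R₀) (M := N)) := by
          refine lhom_ext fun n x => ?_
          simp only [LinearMap.comp_apply, Algebra.lsmul_coe, smul_single 𝒜 N ha, lift_single,
            LinearMap.id_apply]
        exact LinearMap.congr_fun h x }

lemma sum_single (n : ℤ) (x : N) : sum 𝒜 N (single 𝒜 N n x) = x :=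
  lift_single 𝒜 N _ n x

end Cofree

variable (𝒜) [GradedAlgebra 𝒜] (N : Type u) [AddCommGroup N] [Module R N] [Module R₀ N]
  [IsScalarTower R₀ R N]

/-- The graded module `⨁_{n ∈ ℤ} N`. -/
noncomputable def cofree : GrMod 𝒜 where
  carrier := Cofree 𝒜 N
  deg n := LinearMap.range (Cofree.single 𝒜 N n)
  isInternal := by
    refine isInternal_of_proj _
      (fun n => Cofree.single 𝒜 N n ∘ₗ (Finsupp.lapply n : (ℤ →₀ N) →ₗ[R₀] N)) ?_ ?_ ?_
    · rintro n _ ⟨x, rfl⟩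
      exact congrArg (Cofree.single 𝒜 N n) (Finsupp.single_eq_same (M := N))
    · rintro m n h _ ⟨x, rfl⟩
      exact (congrArg (Cofree.single 𝒜 N n) (Finsupp.single_eq_of_ne (M := N) h.symm)).trans
        (map_zero _)
    · intro x
      exact Finsupp.induction_linear (M := N) x (zero_mem _) (fun _ _ => add_mem)
        fun n y => Submodule.mem_iSup_of_mem n ⟨y, rfl⟩
  smul_mem := by
    rintro m n a _ ha ⟨x, rfl⟩
    exact ⟨a • x, (Cofree.smul_single 𝒜 N ha n x).symm⟩

variable {𝒜 N}

/-- Two morphisms to `⨁_{n ∈ ℤ} N` agree if they have the same sum. -/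
lemma cofree_hom_ext {f g : X ⟶ cofree 𝒜 N}
    (h : ∀ x, Cofree.sum 𝒜 N (f.toLin x) = Cofree.sum 𝒜 N (g.toLin x)) : f = g := by
  ext x
  refine Submodule.iSup_induction (motive := fun x => f.toLin x = g.toLin x) _ (X.mem_iSup_deg x)
    ?_ (by simp) (fun x y hx hy => by simp [hx, hy])
  intro n x hx
  obtain ⟨y, hy⟩ := f.map_deg hx
  obtain ⟨z, hz⟩ := g.map_deg hx
  have := h x
  rw [← hy, ← hz] at this ⊢
  erw [Cofree.sum_single, Cofree.sum_single] at this
  rw [this]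

/-- The morphism to `⨁_{n ∈ ℤ} N` with a given sum. -/
lemma exists_cofree_hom (h : X →ₗ[R] N) :
    ∃ f : X ⟶ cofree 𝒜 N, ∀ x, Cofree.sum 𝒜 N (f.toLin x) = h x := by
  let e := LinearEquiv.ofBijective (DirectSum.coeLinearMap X.deg) X.isInternal
  let φ : X →ₗ[R₀] Cofree 𝒜 N :=
    DirectSum.toModule R₀ ℤ _ (fun n => Cofree.single 𝒜 N n ∘ₗ h.restrictScalars R₀ ∘ₗ
      (X.deg n).subtype) ∘ₗ e.symm.toLinearMap
  have hφ : ∀ n, ∀ x ∈ X.deg n, φ x = Cofree.single 𝒜 N n (h x) := by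
    intro n x hx
    have : e.symm x = DirectSum.lof R₀ ℤ (fun n => X.deg n) n ⟨x, hx⟩ := by
      rw [LinearEquiv.symm_apply_eq]
      exact (DirectSum.coeLinearMap_lof X.deg n ⟨x, hx⟩).symm
    simp only [φ, LinearMap.comp_apply, LinearEquiv.coe_coe, this, DirectSum.toModule_lof]
    rfl
  refine ⟨⟨{ φ with map_smul' := Cofree.map_smul_of_homogeneous (𝒜 := 𝒜) φ.toAddMonoidHom ?_ },
    fun {n x} hx => ⟨h x, (hφ n x hx).symm⟩⟩, ?_⟩
  · intro m a ha x
    refine Submodule.iSup_induction (motive := fun x => φ (a • x) = a • φ x) _ (X.mem_iSup_deg x)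
      ?_ (by simp) (fun x y hx hy => by simp [hx, hy])
    intro n x hx
    rw [hφ n x hx, hφ _ _ (X.smul_mem ha hx), Cofree.smul_single 𝒜 N ha, map_smul]
  · intro x
    refine Submodule.iSup_induction (motive := fun x => Cofree.sum 𝒜 N (φ x) = h x) _
      (X.mem_iSup_deg x) ?_ (by simp) (fun x y hx hy => by simp [hx, hy])
    intro n x hx
    rw [hφ n x hx, Cofree.sum_single]

/-- Graded modules `⨁_{n ∈ ℤ} I` with `I` an injective module are injective. -/
lemma injective_cofree (hN : Injective (ModuleCat.of R N)) : Injective (cofree 𝒜 N) where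
  factors {X Y} g f _ := by
    have : Mono (ModuleCat.ofHom f.toLin) :=
      (ModuleCat.mono_iff_injective _).2 (injective_of_mono f)
    obtain ⟨h, hh⟩ := hN.factors (ModuleCat.ofHom (Cofree.sum 𝒜 N ∘ₗ g.toLin))
      (ModuleCat.ofHom f.toLin)
    obtain ⟨k, hk⟩ := exists_cofree_hom (𝒜 := 𝒜) h.hom
    refine ⟨k, cofree_hom_ext fun x => (hk _).trans ?_⟩
    exact congrArg (fun l => l.hom x) hh

instance : EnoughInjectives (GrMod 𝒜) where
  presentation X := by
    let I : ModuleCat.{u} R := Injective.under (ModuleCat.of R X)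
    let j : ModuleCat.of R X ⟶ I := Injective.ι _
    let _ : Module R₀ I := Module.compHom I (algebraMap R₀ R)
    have : IsScalarTower R₀ R I := IsScalarTower.of_algebraMap_smul fun _ _ => rfl
    have hI : Injective (ModuleCat.of R I) := inferInstanceAs (Injective I)
    obtain ⟨f, hf⟩ := exists_cofree_hom (𝒜 := 𝒜) j.hom
    refine ⟨⟨cofree 𝒜 I, injective_cofree hI, f, mono_of_injective f fun x y h => ?_⟩⟩
    have hj : Function.Injective j.hom := (ModuleCat.mono_iff_injective j).1 inferInstance
    exact hj (by rw [← hf, ← hf, h])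

end Cofree

end GrMod

section Torsion

variable {M : Type u} [AddCommGroup M] [Module R M]

lemma pow_smul_span_le_iff (I J : Ideal R) (x : M) :
    I • Submodule.span R {x} ≤ J • Submodule.span R {x} ↔
      I ≤ (Submodule.span R {x}).annihilator ⊔ J := by
  constructor
  · intro h a ha
    obtain ⟨j, hj, hjx⟩ := Submodule.mem_smul_span_singleton.1
      (h (Submodule.mem_smul_span_singleton.2 ⟨a, ha, rfl⟩))
    have : a = (a - j) + j := by ring
    rw [this]
    refine Submodule.add_mem_sup ?_ hj
    rw [Submodule.mem_annihilator_span_singleton, sub_smul, hjx, sub_self]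
  · intro h y hy
    obtain ⟨a, ha, rfl⟩ := Submodule.mem_smul_span_singleton.1 hy
    obtain ⟨b, hb, j, hj, rfl⟩ := Submodule.mem_sup.1 (h ha)
    rw [Submodule.mem_annihilator_span_singleton] at hb
    rw [add_smul, hb, zero_add]
    exact Submodule.mem_smul_span_singleton.2 ⟨j, hj, rfl⟩

lemma torsion_iff (I J : Ideal R) (x : M) :
    (∃ n₀ : ℕ, ∀ n ≥ n₀, I ^ n • Submodule.span R {x} ≤ J • Submodule.span R {x}) ↔
      ∃ n : ℕ, I ^ n ≤ (Submodule.span R {x}).annihilator ⊔ J := by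
  simp only [pow_smul_span_le_iff]
  exact ⟨fun ⟨n, h⟩ => ⟨n, h n le_rfl⟩,
    fun ⟨n, h⟩ => ⟨n, fun m hm => (Ideal.pow_le_pow_right hm).trans h⟩⟩

variable (M) in
/-- `Γ_{I,J}(M) = {x ∈ M | I ^ n x ⊆ J x for all large n}`. -/
def torsion (I J : Ideal R) : Submodule R M where
  carrier := {x | ∃ n₀ : ℕ, ∀ n ≥ n₀, I ^ n • Submodule.span R {x} ≤ J • Submodule.span R {x}}
  zero_mem' := ⟨0, by simp⟩
  add_mem' := by
    intro x y hx hy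
    rw [Set.mem_ofPred_eq, torsion_iff] at *
    obtain ⟨m, hm⟩ := hx
    obtain ⟨n, hn⟩ := hy
    refine ⟨m + n, ?_⟩
    rw [pow_add]
    refine (Ideal.mul_mono hm hn).trans ?_
    rw [Ideal.sup_mul, Ideal.mul_sup]
    refine sup_le (sup_le ?_ ?_) ?_
    · refine le_trans (Ideal.mul_le.2 fun a ha b hb => ?_) le_sup_left
      rw [Submodule.mem_annihilator_span_singleton] at *
      rw [smul_add, mul_smul a b y, hb, mul_comm, mul_smul, ha, smul_zero, smul_zero, add_zero]
    · exact le_trans (Ideal.mul_le.2 fun a _ b hb => J.mul_mem_left a hb) le_sup_right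
    · exact le_trans (Ideal.mul_le.2 fun a ha b _ => J.mul_mem_right b ha) le_sup_right
  smul_mem' := by
    intro a x hx
    rw [Set.mem_ofPred_eq, torsion_iff] at *
    obtain ⟨n, hn⟩ := hx
    refine ⟨n, hn.trans (sup_le_sup_right (Submodule.annihilator_mono ?_) _)⟩
    rw [Submodule.span_singleton_le_iff_mem]
    exact Submodule.smul_mem _ _ (Submodule.mem_span_singleton_self x)

lemma mem_torsion_iff (I J : Ideal R) (x : M) : x ∈ torsion M I J ↔
    ∃ n : ℕ, I ^ n ≤ (Submodule.span R {x}).annihilator ⊔ J :=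
  torsion_iff I J x

lemma map_mem_torsion {N : Type u} [AddCommGroup N] [Module R N] (I J : Ideal R) (f : M →ₗ[R] N)
    {x : M} (hx : x ∈ torsion M I J) : f x ∈ torsion N I J := by
  rw [mem_torsion_iff] at *
  obtain ⟨n, hn⟩ := hx
  refine ⟨n, hn.trans (sup_le_sup_right ?_ _)⟩
  intro a ha
  rw [Submodule.mem_annihilator_span_singleton] at *
  rw [← map_smul, ha, map_zero]

/-- If `a N ⊆ J N` with `N` finitely generated, a power of `a` lies in `Ann N + J`. -/
lemma mem_radical_of_smul_le (J : Ideal R) (N : Submodule R M) (hN : N.FG) (a : R)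
    (ha : ∀ x ∈ N, a • x ∈ J • N) : a ∈ (N.annihilator ⊔ J).radical := by
  have : Module.Finite R N := Module.Finite.iff_fg.2 hN
  obtain ⟨p, hp, -, hc, h0⟩ :=
    LinearMap.exists_monic_and_natDegree_eq_and_coeff_mem_pow_and_aeval_eq_zero R
      (algebraMap R (Module.End R N) a) J (by
        rintro _ ⟨x, rfl⟩
        have h := ha x x.2
        have e : J • N = (J • (⊤ : Submodule R N)).map N.subtype := by
          rw [Submodule.map_smul'', Submodule.map_top, Submodule.range_subtype]
        rw [e] at h
        obtain ⟨y, hy, hyx⟩ := h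
        have : y = algebraMap R (Module.End R N) a x := Subtype.ext hyx
        rwa [← this])
  refine ⟨p.natDegree, ?_⟩
  have h1 : p.eval a ∈ N.annihilator := by
    rw [Submodule.mem_annihilator]
    intro x hx
    rw [Polynomial.aeval_algebraMap_apply, Polynomial.coe_aeval_eq_eval] at h0
    exact congrArg Subtype.val (LinearMap.congr_fun h0 ⟨x, hx⟩)
  rw [Polynomial.eval_eq_sum_range, Finset.sum_range_succ, hp.coeff_natDegree, one_mul] at h1
  have h2 : ∑ k ∈ Finset.range p.natDegree, p.coeff k * a ^ k ∈ J := by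
    refine Ideal.sum_mem _ fun k hk => Ideal.mul_mem_right _ _ ?_
    have hk' : p.natDegree - k ≠ 0 := by
      have := Finset.mem_range.1 hk
      omega
    exact Ideal.pow_le_self hk' (hc k)
  have h3 : a ^ p.natDegree =
      (∑ k ∈ Finset.range p.natDegree, p.coeff k * a ^ k + a ^ p.natDegree) +
        -∑ k ∈ Finset.range p.natDegree, p.coeff k * a ^ k := by ring
  rw [h3]
  exact Submodule.add_mem_sup h1 (neg_mem h2)

end Torsion

section GradedTorsion

lemma proj_smul (X : GrMod 𝒜) {m : ℕ} {a : R} (ha : a ∈ 𝒜 m) (n : ℤ) (x : X) :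
    X.proj n (a • x) = a • X.proj (n - m) x := by
  refine Submodule.iSup_induction
    (motive := fun x => X.proj n (a • x) = a • X.proj (n - m) x) _ (X.mem_iSup_deg x)
    ?_ (by simp) (fun x y hx hy => by rw [smul_add, map_add, hx, hy, map_add, smul_add])
  intro k x hx
  have h := X.smul_mem ha hx
  by_cases hk : (m + k : ℤ) = n
  · subst hk
    rw [X.proj_same h, add_sub_cancel_left, X.proj_same hx]
  · rw [X.proj_ne hk h, X.proj_ne (fun h' => hk (by omega)) hx, smul_zero]

variable [GradedAlgebra 𝒜]

/-- `J N` is homogeneous if `J` and `N` are. -/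
lemma proj_mem_smul (X : GrMod 𝒜) (J : Ideal R) (hJ : J.IsHomogeneous 𝒜) (N : Submodule R X)
    (hN : ∀ x ∈ N, ∀ n, X.proj n x ∈ N) (z : X) (hz : z ∈ J • N) (n : ℤ) :
    X.proj n z ∈ J • N := by
  classical
  induction hz using Submodule.smul_induction_on' with
  | add x _ y _ hx hy => rw [map_add]; exact add_mem hx hy
  | smul a ha x hx =>
    rw [← DirectSum.sum_support_decompose 𝒜 a, Finset.sum_smul, map_sum]
    refine Submodule.sum_mem _ fun m _ => ?_
    rw [proj_smul X (Submodule.coe_mem _)]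
    exact Submodule.smul_mem_smul (hJ m ha) (hN x hx _)

/-- `Γ_{I,J}(M)` is a homogeneous submodule. -/
lemma proj_mem_torsion [IsNoetherianRing R] (X : GrMod 𝒜) (I J : HomogeneousIdeal 𝒜) (x : X)
    (hx : x ∈ torsion X I.toIdeal J.toIdeal) (k : ℤ) :
    X.proj k x ∈ torsion X I.toIdeal J.toIdeal := by
  classical
  rw [mem_torsion_iff] at *
  obtain ⟨n, hn⟩ := hx
  obtain ⟨s, hs, hs'⟩ := X.exists_eq_sum x
  let N : Submodule R X := Submodule.span R ((fun k => X.proj k x) '' (s : Set ℤ))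
  have hxN : ∀ k, X.proj k x ∈ N := by
    intro k
    by_cases hk : k ∈ s
    · exact Submodule.subset_span ⟨k, hk, rfl⟩
    · rw [hs' k hk]; exact zero_mem _
  have hNfg : N.FG := Submodule.fg_span (s.finite_toSet.image _)
  have hN : ∀ y ∈ N, ∀ m, X.proj m y ∈ N := by
    intro y hy
    induction hy using Submodule.span_induction with
    | zero => simp
    | add y z _ _ hy hz => intro m; rw [map_add]; exact add_mem (hy m) (hz m)
    | mem y hy =>
      intro m
      obtain ⟨k, -, rfl⟩ := hy
      by_cases h : k = m
      · subst h; rw [X.proj_same (X.proj_mem _ _)]; exact hxN _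
      · rw [X.proj_ne h (X.proj_mem _ _)]; exact zero_mem _
    | smul a y _ hy =>
      intro m
      rw [← DirectSum.sum_support_decompose 𝒜 a, Finset.sum_smul, map_sum]
      refine Submodule.sum_mem _ fun l _ => ?_
      rw [proj_smul X (Submodule.coe_mem _)]
      exact Submodule.smul_mem _ _ (hy _)
  have hIn : (I.toIdeal ^ n).IsHomogeneous 𝒜 := by
    clear hn
    induction n with
    | zero => rw [pow_zero, Ideal.one_eq_top]; exact Ideal.IsHomogeneous.top 𝒜
    | succ n ih => rw [pow_succ]; exact ih.mul I.isHomogeneous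
  have hxN' : x ∈ N := by rw [hs]; exact Submodule.sum_mem _ fun k _ => hxN k
  have key : I.toIdeal ^ n • N ≤ J.toIdeal • N := by
    have hhom : ∀ m : ℕ, ∀ a ∈ 𝒜 m, a ∈ I.toIdeal ^ n → ∀ k, a • X.proj k x ∈ J.toIdeal • N := by
      intro m a ha haI k
      have h1 : a • x ∈ J.toIdeal • N := by
        obtain ⟨b, hb, j, hj, rfl⟩ := Submodule.mem_sup.1 (hn haI)
        rw [Submodule.mem_annihilator_span_singleton] at hb
        rw [add_smul, hb, zero_add]
        exact Submodule.smul_mem_smul hj hxN'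
      have h2 : X.proj (m + k) (a • x) = a • X.proj k x := by
        rw [proj_smul X ha, add_sub_cancel_left]
      rw [← h2]
      exact proj_mem_smul X _ J.isHomogeneous N hN _ h1 _
    rw [Submodule.smul_le]
    intro a ha y hy
    induction hy using Submodule.span_induction with
    | zero => simp
    | add y z _ _ hy hz => rw [smul_add]; exact add_mem hy hz
    | smul b y _ hy => rw [smul_comm]; exact Submodule.smul_mem _ _ hy
    | mem y hy =>
      obtain ⟨k, -, rfl⟩ := hy
      rw [← DirectSum.sum_support_decompose 𝒜 a, Finset.sum_smul]
      exact Submodule.sum_mem _ fun m _ => hhom m _ (Submodule.coe_mem _) (hIn m ha) k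
  have hrad : I.toIdeal ^ n ≤ (N.annihilator ⊔ J.toIdeal).radical := fun a ha =>
    mem_radical_of_smul_le _ N hNfg a fun y hy => key (Submodule.smul_mem_smul ha hy)
  obtain ⟨t, ht⟩ := Ideal.exists_pow_le_of_le_radical_of_fg hrad (IsNoetherian.noetherian _)
  refine ⟨n * t, ?_⟩
  rw [pow_mul]
  refine ht.trans (sup_le_sup_right (Submodule.annihilator_mono ?_) _)
  rw [Submodule.span_singleton_le_iff_mem]
  exact hxN k

variable [IsNoetherianRing R]

/-- The functor `Γ_{I,J}` on graded modules. -/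
noncomputable def torsionFunctor (I J : HomogeneousIdeal 𝒜) : GrMod 𝒜 ⥤ GrMod 𝒜 where
  obj X := X.sub (torsion X I.toIdeal J.toIdeal) (proj_mem_torsion X I J)
  map {X Y} f := ⟨f.toLin.restrict fun _ hx => map_mem_torsion _ _ f.toLin hx,
    fun h => f.map_deg h⟩

instance (I J : HomogeneousIdeal 𝒜) : (torsionFunctor I J).Additive where

/-- `H^i_{I,J}(M)`, the `i`-th right derived functor of `Γ_{I,J}` on graded modules. -/
noncomputable def localCohomology (I J : HomogeneousIdeal 𝒜) (i : ℕ) (M : GrMod 𝒜) : GrMod 𝒜 :=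
  ((torsionFunctor I J).rightDerived i).obj M

/-- `R = ⨁ 𝒜 m` is standard graded with base ring `R₀`: the structure map identifies `R₀` with the
degree zero part, and `R` is generated over `R₀` by finitely many elements of degree one. -/
structure IsStandardGraded (𝒜 : ℕ → Submodule R₀ R) : Prop where
  algebraMap_injective : Function.Injective (algebraMap R₀ R)
  mem_range_of_degree_zero : ∀ a ∈ 𝒜 0, a ∈ (algebraMap R₀ R).range
  generated : ∃ S : Finset R, (∀ a ∈ S, a ∈ 𝒜 1) ∧ Algebra.adjoin R₀ (S : Set R) = ⊤

/-- The sets `S n` become constant as `n → -∞`. -/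
def AsymptoticallyStable (S : ℤ → Set (Ideal R₀)) : Prop :=
  ∃ n₀ : ℤ, ∀ n ≤ n₀, S n = S n₀

end GradedTorsion

end GradedModules
end GradedLC

/-! Write `H^k` for local cohomology with respect to `(R_+, J)` and `Γ` for the torsion functor. The
proof is by induction on `i`. For `i = 0` the module `H^0(M) = Γ(M)` is finite over an `ℕ`-graded
ring, so its components vanish in all sufficiently low degrees.

For the step from `i` to `i + 1`, replace `M` by `X = M/Γ(M)`. This kills `H^0` and leaves the
higher cohomology unchanged, because torsion modules have no higher cohomology
(`subsingleton_localCohomology_of_torsion`). That vanishing rests on `injective_torsionFunctor_obj`: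
`Γ(E)` is a direct summand of `E` when `E` is injective. Since `Γ(X) = 0`, no associated prime of
`X` contains `R_+`, and the infinite residue field allows prime avoidance in degree one: some `a` of
degree one is regular on `X` (`exists_regular`). With `N = X/aX`, the long exact sequence reads
`H^i(X)_n → H^i(N)_n → H^{i+1}(X)_{n-1} → H^{i+1}(X)_n`, and `N` satisfies the finiteness hypothesis
below `i`. For `n ≪ 0` the first term is zero, so `Ass H^i(N)_n ⊆ Ass H^{i+1}(X)_{n-1} ⊆ Ass
H^i(N)_n ∪ Ass H^{i+1}(X)_n`. By induction `Ass H^i(N)_n` is a constant set for `n ≪ 0`, so the sets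
`Ass H^{i+1}(X)_n` eventually decrease as `n → -∞`; if they are finite, they stabilize
(`asymptoticallyStable_of_subset`).

Finiteness is immediate under (b). Under (a) it is proved by descending induction on `n`, starting
where the components vanish. For larger `n` the first term is only finitely generated, so finiteness
of `Ass` alone would not propagate. The stronger property `HasFiniteAssQuotients` does
(`HasFiniteAssQuotients.of_exact`), and it is carried along in the main induction.

The long exact sequence of derived functors comes from the horseshoe lemma, which is obtained from
injective resolutions in the category of arrows. -/

namespace CategoryTheory

open Limits

universe v₁ v₂ u₁ u₂

section

/-! ### Injective objects in the category of arrows -/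

section ArrowInjectives

variable {C : Type u₁} [Category.{v₁} C] [Abelian C]

namespace ComposableArrows

/-- The arrow `I ⊞ K ⟶ K`, cofree on the pair `(I, K)`. -/
noncomputable abbrev cofreeArrow (I K : C) : ComposableArrows C 1 :=
  mk₁ (biprod.snd : I ⊞ K ⟶ K)

/-- The morphism to a cofree arrow determined by its two components. -/
noncomputable def toCofreeArrow {X : ComposableArrows C 1} {I K : C} (f : X.obj' 0 ⟶ I)
    (g : X.obj' 1 ⟶ K) : X ⟶ cofreeArrow I K :=
  homMk₁ (biprod.lift f (X.map' 0 1 ≫ g)) g (biprod.lift_snd _ _).symm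

/-- The remaining coordinate, the projection of the source component to `K`, is forced by the
commutative square. -/
lemma cofreeArrow_hom_ext {X : ComposableArrows C 1} {I K : C} {f g : X ⟶ cofreeArrow I K}
    (h₀ : app' f 0 ≫ biprod.fst = app' g 0 ≫ biprod.fst) (h₁ : app' f 1 = app' g 1) : f = g := by
  refine hom_ext₁ (biprod.hom_ext _ _ h₀ ?_) h₁
  have hf := naturality' f 0 1
  have hg := naturality' g 0 1
  simp only [h₁] at hf
  exact hf.symm.trans hg

lemma mono_app (X Y : ComposableArrows C 1) (f : X ⟶ Y) [Mono f] (k : Fin 2) : Mono (f.app k) :=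
  inferInstanceAs (Mono (((evaluation _ _).obj k).map f))

/-- A morphism to a cofree arrow amounts to two unrelated morphisms, to `I` and to `K`, and these
extend separately. -/
instance injective_cofreeArrow (I K : C) [Injective I] [Injective K] :
    Injective (cofreeArrow I K) where
  factors {X Y} g f _ := by
    have h0 := mono_app _ _ f 0
    have h1 := mono_app _ _ f 1
    refine ⟨toCofreeArrow (Injective.factorThru (app' g 0 ≫ biprod.fst) (app' f 0))
      (Injective.factorThru (app' g 1) (app' f 1)), cofreeArrow_hom_ext ?_ ?_⟩
    · refine (Category.assoc _ _ _).trans ?_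
      refine (congrArg _ (biprod.lift_fst _ _)).trans ?_
      exact Injective.comp_factorThru _ _
    · exact Injective.comp_factorThru (J := K) _ _

lemma mono_toCofreeArrow {X : ComposableArrows C 1} {I K : C} (f : X.obj' 0 ⟶ I)
    (g : X.obj' 1 ⟶ K) [Mono f] [Mono g] : Mono (toCofreeArrow (X := X) f g) := by
  have h : ∀ k, Mono ((toCofreeArrow (X := X) f g).app k) := by
    intro k
    fin_cases k
    · exact mono_of_mono_fac (biprod.lift_fst f (X.map' 0 1 ≫ g))
    · exact inferInstanceAs (Mono g)
  exact NatTrans.mono_of_mono_app _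

/-- The standard embedding of an arrow into a cofree injective arrow. -/
noncomputable def underArrow [EnoughInjectives C] (X : ComposableArrows C 1) :
    X ⟶ cofreeArrow (Injective.under (X.obj' 0)) (Injective.under (X.obj' 1)) :=
  toCofreeArrow (Injective.ι _) (Injective.ι _)

instance [EnoughInjectives C] (X : ComposableArrows C 1) : Mono (underArrow X) :=
  mono_toCofreeArrow _ _

instance [EnoughInjectives C] : EnoughInjectives (ComposableArrows C 1) where
  presentation X := ⟨⟨_, inferInstance, underArrow X, inferInstance⟩⟩

variable [EnoughInjectives C] (X : ComposableArrows C 1) [Injective X]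

/-- An injective arrow is a retract of a cofree one. -/
noncomputable def retractUnderArrow :
    Retract X (cofreeArrow (Injective.under (X.obj' 0)) (Injective.under (X.obj' 1))) where
  i := underArrow X
  r := Injective.factorThru (𝟙 X) (underArrow X)
  retract := Injective.comp_factorThru _ _

lemma injective_obj_of_injective (k : Fin 2) : Injective (X.obj k) := by
  have r := (retractUnderArrow X).map ((evaluation _ _).obj k)
  have : Injective (((evaluation (Fin 2) C).obj k).obj
      (cofreeArrow (Injective.under (X.obj' 0)) (Injective.under (X.obj' 1)))) := by
    fin_cases k
    · exact inferInstanceAs (Injective (_ ⊞ _))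
    · exact inferInstanceAs (Injective (Injective.under _))
  exact r.injective

/-- An injective arrow is a split epimorphism. -/
noncomputable def splitEpiOfInjective : SplitEpi (X.map' 0 1) where
  section_ := app' (retractUnderArrow X).i 1 ≫ biprod.inr ≫ app' (retractUnderArrow X).r 0
  id := by
    have h := naturality' (retractUnderArrow X).r 0 1
    have h' := congrArg (fun f => app' f 1) (retractUnderArrow X).retract
    -- The cofree arrow is split by `biprod.inr`; the retraction carries this section over to `X`.
    have key : (biprod.inr ≫ app' (retractUnderArrow X).r 0) ≫ X.map' 0 1 =
        app' (retractUnderArrow X).r 1 :=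
      (Category.assoc _ _ _).trans
        ((congrArg (biprod.inr ≫ ·) h.symm).trans (biprod.inr_snd_assoc _))
    exact (Category.assoc _ _ _).trans ((congrArg _ key).trans h')

instance : IsSplitEpi (X.map' 0 1) := ⟨⟨splitEpiOfInjective X⟩⟩

end ComposableArrows

end ArrowInjectives

end

/-! ### Resolutions under exact functors, and resolutions of epimorphisms -/

section

variable {C : Type u₁} [Category.{v₁} C] [Abelian C] {D : Type u₂} [Category.{v₂} D] [Abelian D]

/-- The image of an injective resolution under an exact functor whose values on its terms are
injective. -/
noncomputable def InjectiveResolution.mapExact {X : C} (P : InjectiveResolution X) (G : C ⥤ D)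
    [G.Additive] [G.PreservesHomology] (hG : ∀ n, Injective (G.obj (P.cocomplex.X n))) :
    InjectiveResolution (G.obj X) where
  cocomplex := (G.mapHomologicalComplex _).obj P.cocomplex
  injective := hG
  ι := (HomologicalComplex.singleMapHomologicalComplex G _ 0).inv.app X ≫
    (G.mapHomologicalComplex _).map P.ι
  quasiIso := by infer_instance

/-- Derived functors of functors that are intertwined by exact functors. -/
lemma Functor.rightDerived_obj_iso_of_exact [EnoughInjectives C] (F : C ⥤ D) [F.Additive]
    (G : C ⥤ C) [G.Additive] [G.PreservesHomology] [G.PreservesInjectiveObjects]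
    (G' : D ⥤ D) [G'.Additive] [G'.PreservesHomology] (e : G ⋙ F ≅ F ⋙ G') (n : ℕ) (X : C) :
    Nonempty ((F.rightDerived n).obj (G.obj X) ≅ G'.obj ((F.rightDerived n).obj X)) := by
  let P := injectiveResolution X
  let Q := P.mapExact G fun n => G.injective_obj _
  let K := (F.mapHomologicalComplex (ComplexShape.up ℕ)).obj P.cocomplex
  let e' : (F.mapHomologicalComplex _).obj Q.cocomplex ≅ (G'.mapHomologicalComplex _).obj K :=
    (NatIso.mapHomologicalComplex e (ComplexShape.up ℕ)).app P.cocomplex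
  exact ⟨Q.isoRightDerivedObj F n ≪≫ (HomologicalComplex.homologyFunctor D _ n).mapIso e' ≪≫
    (K.sc n).mapHomologyIso G' ≪≫ G'.mapIso (P.isoRightDerivedObj F n).symm⟩

section Horseshoe

variable [EnoughInjectives C]

/-- Resolve `g` in the category of arrows. Evaluation at the two ends is exact and keeps injectives
injective, and every injective arrow is a split epimorphism. -/
lemma Abelian.exists_resolution_of_epi {B A : C} (g : B ⟶ A) [Epi g] :
    ∃ (P : InjectiveResolution B) (Q : InjectiveResolution A) (ψ : P.cocomplex ⟶ Q.cocomplex),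
      (∀ n, IsSplitEpi (ψ.f n)) ∧
      P.ι ≫ ψ = (CochainComplex.single₀ C).map g ≫ Q.ι := by
  let X : ComposableArrows C 1 := ComposableArrows.mk₁ g
  let T := injectiveResolution X
  let P := T.mapExact ((evaluation (Fin 2) C).obj 0) fun n =>
    ComposableArrows.injective_obj_of_injective _ _
  let Q := T.mapExact ((evaluation (Fin 2) C).obj 1) fun n =>
    ComposableArrows.injective_obj_of_injective _ _
  let τ : (evaluation (Fin 2) C).obj 0 ⟶ (evaluation (Fin 2) C).obj 1 :=
    (evaluation (Fin 2) C).map (homOfLE (by decide))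
  let ψ : P.cocomplex ⟶ Q.cocomplex :=
    (NatTrans.mapHomologicalComplex τ _).app T.cocomplex
  refine ⟨P, Q, ψ, fun n => inferInstanceAs (IsSplitEpi ((T.cocomplex.X n).map' 0 1)), ?_⟩
  refine HomologicalComplex.from_single_hom_ext ?_
  -- The comparison of single complexes is the identity in degree zero, so both augmentations are
  -- the evaluations of `T.ι`, and compatibility is its naturality.
  have hι (k : Fin 2) : ((HomologicalComplex.singleMapHomologicalComplex
      ((evaluation (Fin 2) C).obj k) (ComplexShape.up ℕ) 0).inv.app X).f 0 = 𝟙 _ := by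
    rw [HomologicalComplex.singleMapHomologicalComplex_inv_app_self]
    exact Category.id_comp (𝟙 (X.obj k))
  have hP : P.ι.f 0 = (T.ι.f 0).app 0 :=
    (congrArg (fun f => f ≫ (T.ι.f 0).app 0) (hι 0)).trans (Category.id_comp _)
  have hQ : Q.ι.f 0 = (T.ι.f 0).app 1 :=
    (congrArg (fun f => f ≫ (T.ι.f 0).app 1) (hι 1)).trans (Category.id_comp _)
  rw [HomologicalComplex.comp_f, HomologicalComplex.comp_f, hP, hQ,
    CochainComplex.single₀_map_f_zero]
  exact ((T.ι.f 0).naturality (homOfLE (show (0 : Fin 2) ≤ 1 by decide))).symm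

end Horseshoe

end

/-! ### The horseshoe lemma and the long exact sequence of derived functors -/

section

variable {C : Type u₁} [Category.{v₁} C] [Abelian C] {D : Type u₂} [Category.{v₂} D] [Abelian D]

-- The five lemma for the long exact homology sequences. In a degree `j` with no incoming
-- differential the sequence starts there with a monomorphism, and the shorter diagram suffices.
open HomologicalComplex HomologicalComplex.HomologySequence in
lemma ShortComplex.quasiIso_τ₁_of_shortExact {ι : Type*} {c : ComplexShape ι}
    {S₁ S₂ : ShortComplex (HomologicalComplex C c)} (φ : S₁ ⟶ S₂) (hS₁ : S₁.ShortExact)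
    (hS₂ : S₂.ShortExact) (h₂ : _root_.QuasiIso φ.τ₂) (h₃ : _root_.QuasiIso φ.τ₃) :
    _root_.QuasiIso φ.τ₁ := by
  rw [_root_.quasiIso_iff]
  intro j
  rw [quasiIsoAt_iff_isIso_homologyMap]
  by_cases hj : ∃ i, c.Rel i j
  · obtain ⟨i, hij⟩ := hj
    refine Abelian.isIso_of_epi_of_isIso_of_isIso_of_mono
      (composableArrows₅_exact hS₁ i j hij).δ₀ (composableArrows₅_exact hS₂ i j hij).δ₀
      (ComposableArrows.δ₀Functor.map (mapComposableArrows₅ φ hS₁ hS₂ i j hij)) ?_ ?_ ?_ ?_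
    · exact inferInstanceAs (Epi (HomologicalComplex.homologyMap φ.τ₂ i))
    · exact inferInstanceAs (IsIso (HomologicalComplex.homologyMap φ.τ₃ i))
    · exact inferInstanceAs (IsIso (HomologicalComplex.homologyMap φ.τ₂ j))
    · exact inferInstanceAs (Mono (HomologicalComplex.homologyMap φ.τ₃ j))
  · have hj' : ∀ i, ¬ c.Rel i j := fun i h => hj ⟨i, h⟩
    have := hS₁.mono_f
    have := hS₂.mono_f
    refine Abelian.isIso_of_isIso_of_mono (mapComposableArrows₂ φ j)
      (composableArrows₂_exact hS₁ j) (composableArrows₂_exact hS₂ j) ?_ ?_ ?_ ?_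
    · exact mono_homologyMap_of_mono_of_not_rel S₁.f j hj'
    · exact mono_homologyMap_of_mono_of_not_rel S₂.f j hj'
    · exact inferInstanceAs (IsIso (HomologicalComplex.homologyMap φ.τ₂ j))
    · exact inferInstanceAs (Mono (HomologicalComplex.homologyMap φ.τ₃ j))

lemma ShortComplex.exact_of_conj {A B E A' B' E' : C} {f : A ⟶ B} {g : B ⟶ E} {f' : A' ⟶ B'}
    {g' : B' ⟶ E'} {w' : f' ≫ g' = 0} (h : (ShortComplex.mk f' g' w').Exact) (a : A ≅ A')
    (b : B ≅ B') (e : E ≅ E') (hf : f ≫ b.hom = a.hom ≫ f') (hg : g ≫ e.hom = b.hom ≫ g') :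
    ∃ w : f ≫ g = 0, (ShortComplex.mk f g w).Exact := by
  have w : f ≫ g = 0 := by
    rw [← cancel_mono e.hom, Category.assoc, hg, reassoc_of% hf, w', comp_zero, zero_comp]
  exact ⟨w, ShortComplex.exact_of_iso (S₂ := ShortComplex.mk f g w)
    (ShortComplex.isoMk a b e hf.symm hg.symm).symm h⟩

variable [EnoughInjectives C]

/-- The horseshoe lemma: a short exact sequence has a degreewise split resolution. -/
lemma ShortComplex.ShortExact.exists_resolution {S : ShortComplex C} (hS : S.ShortExact) :
    ∃ (P₁ : InjectiveResolution S.X₁) (P₂ : InjectiveResolution S.X₂)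
      (P₃ : InjectiveResolution S.X₃) (φ : P₁.cocomplex ⟶ P₂.cocomplex)
      (ψ : P₂.cocomplex ⟶ P₃.cocomplex) (w : φ ≫ ψ = 0),
      (∀ n, Nonempty ((ShortComplex.mk φ ψ w).map (HomologicalComplex.eval _ _ n)).Splitting) ∧
      P₁.ι ≫ φ = (CochainComplex.single₀ C).map S.f ≫ P₂.ι ∧
      P₂.ι ≫ ψ = (CochainComplex.single₀ C).map S.g ≫ P₃.ι := by
  have := hS.epi_g
  obtain ⟨P₂, P₃, ψ, hψ, h⟩ := Abelian.exists_resolution_of_epi S.g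
  have : Epi ψ := HomologicalComplex.epi_of_epi_f _ fun n => by
    have := hψ n
    infer_instance
  let T := ShortComplex.mk (kernel.ι ψ) ψ (kernel.condition ψ)
  have hT : T.ShortExact :=
    { exact := ShortComplex.exact_of_f_is_kernel _ (kernelIsKernel ψ) }
  have hTn (n : ℕ) : (T.map (HomologicalComplex.eval _ _ n)).ShortExact := hT.map_of_exact _
  have hs (n : ℕ) : Nonempty (T.map (HomologicalComplex.eval _ _ n)).Splitting := by
    have := (hTn n).mono_f
    obtain ⟨⟨σ⟩⟩ := hψ n
    exact ⟨ShortComplex.Splitting.ofExactOfSection _ (hTn n).exact σ.section_ σ.id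
      inferInstance⟩
  let ι₁ : (CochainComplex.single₀ C).obj S.X₁ ⟶ kernel ψ :=
    kernel.lift ψ ((CochainComplex.single₀ C).map S.f ≫ P₂.ι) (by
      rw [Category.assoc, h, ← Functor.map_comp_assoc, S.zero, Functor.map_zero, zero_comp])
  have hι₁ : ι₁ ≫ kernel.ι ψ = (CochainComplex.single₀ C).map S.f ≫ P₂.ι := kernel.lift_ι _ _ _
  let α : S.map (CochainComplex.single₀ C) ⟶ T :=
    { τ₁ := ι₁
      τ₂ := P₂.ι
      τ₃ := P₃.ι
      comm₁₂ := hι₁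
      comm₂₃ := h }
  -- The kernel of `ψ` resolves `S.X₁`: two of the three augmentations are quasi-isomorphisms, hence
  -- so is the third.
  have hq : _root_.QuasiIso ι₁ := ShortComplex.quasiIso_τ₁_of_shortExact α (hS.map_of_exact _) hT
    P₂.quasiIso P₃.quasiIso
  let P₁ : InjectiveResolution S.X₁ :=
    { cocomplex := kernel ψ
      injective := fun n => by
        obtain ⟨s⟩ := hs n
        have : Injective (T.map (HomologicalComplex.eval _ _ n)).X₂ := P₂.injective n
        exact Retract.injective ⟨_, _, s.f_r⟩
      ι := ι₁
      quasiIso := hq }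
  exact ⟨P₁, P₂, P₃, kernel.ι ψ, ψ, kernel.condition ψ, hs, hι₁, h⟩

/-- The long exact sequence of right derived functors. -/
theorem Functor.rightDerived_exact (F : C ⥤ D) [F.Additive] {S : ShortComplex C}
    (hS : S.ShortExact) (n : ℕ) :
    ∃ δ : (F.rightDerived n).obj S.X₃ ⟶ (F.rightDerived (n + 1)).obj S.X₁,
      (∃ w : (F.rightDerived n).map S.f ≫ (F.rightDerived n).map S.g = 0,
        (ShortComplex.mk _ _ w).Exact) ∧
      (∃ w : (F.rightDerived n).map S.g ≫ δ = 0, (ShortComplex.mk _ _ w).Exact) ∧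
      ∃ w : δ ≫ (F.rightDerived (n + 1)).map S.f = 0, (ShortComplex.mk _ _ w).Exact := by
  obtain ⟨P₁, P₂, P₃, φ, ψ, w, hs, hφ, hψ⟩ := hS.exists_resolution
  let T := (ShortComplex.mk φ ψ w).map (F.mapHomologicalComplex (ComplexShape.up ℕ))
  -- Degreewise splitting survives any additive functor, so no exactness of `F` is needed.
  have hT : T.ShortExact := HomologicalComplex.shortExact_of_degreewise_shortExact _ fun n => by
    obtain ⟨s⟩ := hs n
    exact (s.map F).shortExact
  have hφ' : P₁.ι.f 0 ≫ φ.f 0 = S.f ≫ P₂.ι.f 0 := by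
    have := congrArg (fun k => k.f 0) hφ
    simpa using this
  have hψ' : P₂.ι.f 0 ≫ ψ.f 0 = S.g ≫ P₃.ι.f 0 := by
    have := congrArg (fun k => k.f 0) hψ
    simpa using this
  let e₁ (n) : (F.rightDerived n).obj S.X₁ ≅ T.X₁.homology n := P₁.isoRightDerivedObj F n
  let e₂ (n) : (F.rightDerived n).obj S.X₂ ≅ T.X₂.homology n := P₂.isoRightDerivedObj F n
  let e₃ (n) : (F.rightDerived n).obj S.X₃ ≅ T.X₃.homology n := P₃.isoRightDerivedObj F n
  have ef (n) : (F.rightDerived n).map S.f ≫ (e₂ n).hom =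
      (e₁ n).hom ≫ HomologicalComplex.homologyMap T.f n :=
    InjectiveResolution.isoRightDerivedObj_hom_naturality S.f P₁ P₂ φ hφ' F n
  have eg (n) : (F.rightDerived n).map S.g ≫ (e₃ n).hom =
      (e₂ n).hom ≫ HomologicalComplex.homologyMap T.g n :=
    InjectiveResolution.isoRightDerivedObj_hom_naturality S.g P₂ P₃ ψ hψ' F n
  exact ⟨(e₃ n).hom ≫ hT.δ n (n + 1) rfl ≫ (e₁ (n + 1)).inv,
    ShortComplex.exact_of_conj (hT.homology_exact₂ n) (e₁ n) (e₂ n) (e₃ n) (ef n) (eg n),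
    ShortComplex.exact_of_conj (hT.homology_exact₃ n (n + 1) rfl) (e₂ n) (e₃ n) (e₁ (n + 1))
      (eg n) (by simp),
    ShortComplex.exact_of_conj (hT.homology_exact₁ n (n + 1) rfl) (e₃ n) (e₁ (n + 1))
      (e₂ (n + 1)) (by simp) (ef (n + 1))⟩

end

end CategoryTheory

namespace GradedLC

open CategoryTheory CategoryTheory.Limits

/-! ### Exactness, homogeneous components and shifts of graded modules -/

section

variable {R₀ R : Type u} [CommRing R₀] [CommRing R] [Algebra R₀ R] {𝒜 : ℕ → Submodule R₀ R}

namespace GrMod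

variable {X Y Z : GrMod 𝒜}

lemma epi_of_surjective (f : X ⟶ Y) (h : Function.Surjective f.toLin) : Epi f :=
  ⟨fun {W} g k hgk => by
    ext w
    obtain ⟨x, rfl⟩ := h w
    exact congrArg (fun k : X ⟶ W => k.toLin x) hgk⟩

lemma toLin_apply_of_eq {f g : X ⟶ Y} (h : f = g) (x : X) : f.toLin x = g.toLin x := by rw [h]

lemma exact_iff (S : ShortComplex (GrMod 𝒜)) :
    S.Exact ↔ Function.Exact S.f.toLin S.g.toLin := by
  have hz : ∀ x, S.g.toLin (S.f.toLin x) = 0 := toLin_apply_of_eq S.zero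
  constructor
  · intro h y
    refine ⟨fun hy => ?_, fun ⟨x, hx⟩ => hx ▸ hz x⟩
    have h1 : S.X₂.subι _ (ker_homogeneous S.g) ≫ S.g = 0 := by ext x; exact x.2
    have h2 : S.f ≫ S.X₂.quotπ _ (range_homogeneous S.f) = 0 := by
      ext x; exact (Submodule.Quotient.mk_eq_zero _).2 ⟨x, rfl⟩
    have h3 := h.comp_eq_zero h1 h2
    exact (Submodule.Quotient.mk_eq_zero _).1 (toLin_apply_of_eq h3 ⟨y, hy⟩)
  · intro h
    rw [S.exact_iff_kernel_ι_comp_cokernel_π_zero]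
    ext x
    obtain ⟨y, hy⟩ := (h _).1 (toLin_apply_of_eq (kernel.condition S.g) x)
    rw [comp_toLin, LinearMap.comp_apply, ← hy]
    exact toLin_apply_of_eq (cokernel.condition S.f) y

lemma shortExact_iff (S : ShortComplex (GrMod 𝒜)) :
    S.ShortExact ↔ Function.Injective S.f.toLin ∧ Function.Exact S.f.toLin S.g.toLin ∧
      Function.Surjective S.g.toLin := by
  constructor
  · intro h
    have := h.mono_f
    have := h.epi_g
    exact ⟨injective_of_mono _, (exact_iff S).1 h.exact, surjective_of_epi _⟩
  · rintro ⟨hf, h, hg⟩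
    have := mono_of_injective _ hf
    have := epi_of_surjective _ hg
    exact { exact := (exact_iff S).2 h }

/-- The restriction of a morphism to the components of degree `n`. -/
def Hom.degMap (f : Hom X Y) (n : ℤ) : X.deg n →ₗ[R₀] Y.deg n :=
  f.toLin₀.restrict fun _ hx => f.map_deg hx

lemma Hom.coe_degMap (f : Hom X Y) (n : ℤ) (x : X.deg n) :
    (f.degMap n x : Y) = f.toLin x := rfl

lemma exact_degMap {f : X ⟶ Y} {g : Y ⟶ Z} (h : Function.Exact f.toLin g.toLin) (n : ℤ) :
    Function.Exact (Hom.degMap f n) (Hom.degMap g n) := by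
  intro y
  constructor
  · intro hy
    obtain ⟨x, hx⟩ := (h y).1 (congrArg Subtype.val hy)
    -- A preimage of a homogeneous element may be replaced by its component of the same degree.
    refine ⟨⟨X.proj n x, X.proj_mem n x⟩, Subtype.ext ?_⟩
    rw [Hom.coe_degMap]
    exact (Hom.map_proj f n x).trans (by rw [hx, Y.proj_same y.2])
  · rintro ⟨x, rfl⟩
    exact Subtype.ext (h.apply_apply_eq_zero x)

/-- An isomorphism restricts to linear equivalences in each degree. -/
noncomputable def isoDegEquiv (e : X ≅ Y) (n : ℤ) : X.deg n ≃ₗ[R₀] Y.deg n :=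
  LinearEquiv.ofLinearMap (Hom.degMap e.hom n) (Hom.degMap e.inv n)
    (by ext y; exact toLin_apply_of_eq e.inv_hom_id (y : Y))
    (by ext x; exact toLin_apply_of_eq e.hom_inv_id (x : X))

/-- The linear equivalence underlying an isomorphism of graded modules. -/
noncomputable def isoLinearEquiv (e : X ≅ Y) : X ≃ₗ[R] Y :=
  LinearEquiv.ofLinearMap e.hom.toLin e.inv.toLin
    (by ext y; exact toLin_apply_of_eq e.inv_hom_id (y : Y))
    (by ext x; exact toLin_apply_of_eq e.hom_inv_id (x : X))

lemma isZero_iff (X : GrMod 𝒜) : IsZero X ↔ Subsingleton X := by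
  rw [IsZero.iff_id_eq_zero]
  refine ⟨fun h => ⟨fun x y => ?_⟩, fun h => by ext x; exact Subsingleton.elim _ _⟩
  exact (toLin_apply_of_eq h x).trans (toLin_apply_of_eq h y).symm

section Shift

/-- The graded module `X(k)`, whose component of degree `n` is that of `X` of degree `n + k`. -/
def shift (k : ℤ) (X : GrMod 𝒜) : GrMod 𝒜 where
  carrier := X
  deg n := X.deg (n + k)
  isInternal := by
    refine isInternal_of_proj _ (fun n => X.proj (n + k)) (fun n x hx => X.proj_same hx)
      (fun m n h x hx => X.proj_ne (by omega) hx) fun x => ?_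
    refine (iSup_le fun n => ?_ : ⨆ n, X.deg n ≤ _) (X.mem_iSup_deg x)
    refine le_trans (le_of_eq ?_) (le_iSup (fun n => X.deg (n + k)) (n - k))
    simp
  smul_mem {m n a x} ha hx := by
    have := X.smul_mem ha hx
    rwa [← add_assoc] at this

variable (𝒜) in
/-- The functor `X ↦ X(k)`. -/
def shiftFunctor (k : ℤ) : GrMod 𝒜 ⥤ GrMod 𝒜 where
  obj X := X.shift k
  map f := ⟨f.toLin, fun h => f.map_deg h⟩

instance (k : ℤ) : (shiftFunctor 𝒜 k).Additive where

instance (k : ℤ) : (shiftFunctor 𝒜 k).PreservesHomology :=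
  Functor.preservesHomology_of_map_exact _ fun S hS =>
    (exact_iff _).2 ((exact_iff S).1 hS)

/-- Shifting by `-k` is inverse to shifting by `k` and preserves monomorphisms; the underlying
linear maps do not change. -/
instance (k : ℤ) : (shiftFunctor 𝒜 k).PreservesInjectiveObjects where
  injective_obj {E} hE :=
    { factors := fun {X Y} g f _ => by
        have : Mono ((shiftFunctor 𝒜 (-k)).map f) :=
          mono_of_injective _ (injective_of_mono f)
        let g' : (shiftFunctor 𝒜 (-k)).obj X ⟶ E := ⟨g.toLin, fun {n x} hx => by
          have := g.map_deg hx
          change g.toLin x ∈ E.deg (n + -k + k) at this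
          rwa [neg_add_cancel_right] at this⟩
        obtain ⟨h, hh⟩ := hE.factors g' ((shiftFunctor 𝒜 (-k)).map f)
        refine ⟨⟨h.toLin, fun {n x} hx => h.map_deg (n := n + k) ?_⟩, ?_⟩
        · change x ∈ Y.deg (n + k + -k)
          rwa [add_neg_cancel_right]
        · ext x
          exact toLin_apply_of_eq hh x }

end Shift

end GrMod

end

section

/-! ### The torsion submodule: annihilators modulo `J` and Artin-Rees -/

section Torsion

variable {R : Type u} [CommRing R] {M : Type u} [AddCommGroup M] [Module R M] {I J : Ideal R}

lemma mem_torsion_of_le_annihilator {𝔞 : Ideal R} {m : ℕ} (h : I ^ m ≤ 𝔞 ⊔ J) {x : M}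
    (hx : ∀ a ∈ 𝔞, a • x = 0) : x ∈ torsion M I J := by
  rw [mem_torsion_iff]
  refine ⟨m, h.trans (sup_le_sup_right (fun a ha => ?_) _)⟩
  rw [Submodule.mem_annihilator_span_singleton]
  exact hx a ha

lemma sup_mul_sup_le (𝔞 𝔟 J : Ideal R) : (𝔞 ⊔ J) * (𝔟 ⊔ J) ≤ 𝔞 * 𝔟 ⊔ J := by
  rw [Ideal.sup_mul, Ideal.mul_sup]
  refine sup_le (sup_le le_sup_left ?_) ?_
  · exact le_trans (Ideal.mul_le.2 fun a _ b hb => J.mul_mem_left a hb) le_sup_right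
  · exact le_trans (Ideal.mul_le.2 fun a ha b _ => J.mul_mem_right b ha) le_sup_right

lemma sup_pow_le (𝔞 J : Ideal R) (n : ℕ) : (𝔞 ⊔ J) ^ n ≤ 𝔞 ^ n ⊔ J := by
  induction n with
  | zero => simp
  | succ n ih =>
    rw [pow_succ, pow_succ]
    exact (Ideal.mul_mono_left ih).trans (sup_mul_sup_le _ _ _)

/-- A finitely generated torsion module has a uniform exponent: the exponents of two summands add
up, because modulo `J` the product of the annihilators lies in their intersection. -/
lemma exists_pow_le_annihilator_sup {N : Submodule R M} (hN : N.FG) (h : N ≤ torsion M I J) :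
    ∃ m : ℕ, I ^ m ≤ N.annihilator ⊔ J := by
  induction N, hN using Submodule.fg_induction with
  | singleton x => exact (mem_torsion_iff I J x).1 (h (Submodule.mem_span_singleton_self x))
  | sup N₁ N₂ _ _ h₁ h₂ =>
    obtain ⟨m, hm⟩ := h₁ (le_sup_left.trans h)
    obtain ⟨n, hn⟩ := h₂ (le_sup_right.trans h)
    refine ⟨m + n, ?_⟩
    rw [pow_add]
    refine (Ideal.mul_mono hm hn).trans ((sup_mul_sup_le _ _ _).trans
      (sup_le_sup_right (le_trans Ideal.mul_le_inf ?_) _))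
    intro a ha
    rw [Submodule.mem_annihilator]
    intro x hx
    obtain ⟨y, hy, z, hz, rfl⟩ := Submodule.mem_sup.1 hx
    rw [smul_add, Submodule.mem_annihilator.1 ha.1 y hy, Submodule.mem_annihilator.1 ha.2 z hz,
      add_zero]

lemma mem_torsion_of_injective {N : Type u} [AddCommGroup N] [Module R N] (f : M →ₗ[R] N)
    (hf : Function.Injective f) {x : M} (hx : f x ∈ torsion N I J) : x ∈ torsion M I J := by
  obtain ⟨m, hm⟩ := (mem_torsion_iff I J _).1 hx
  refine mem_torsion_of_le_annihilator hm fun a ha => hf ?_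
  rw [Submodule.mem_annihilator_span_singleton] at ha
  rw [map_smul, ha, map_zero]

/-- If `𝔟` is the annihilator of the class of `x`, then `𝔟x` is finitely generated and torsion.
Modulo `J`, powers of `I` lie both in `𝔟` and in `Ann(𝔟x)`, and `Ann(𝔟x) * 𝔟` kills `x`. -/
lemma torsion_quotient_torsion [IsNoetherianRing R] : torsion (M ⧸ torsion M I J) I J = ⊥ := by
  rw [eq_bot_iff]
  intro y hy
  obtain ⟨x, rfl⟩ := Submodule.mkQ_surjective _ y
  obtain ⟨n, hn⟩ := (mem_torsion_iff I J _).1 hy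
  set 𝔟 := (Submodule.span R {(torsion M I J).mkQ x}).annihilator
  have h𝔟 : 𝔟 • Submodule.span R {x} ≤ torsion M I J := by
    intro z hz
    obtain ⟨b, hb, rfl⟩ := Submodule.mem_smul_span_singleton.1 hz
    rw [Submodule.mem_annihilator_span_singleton, ← map_smul] at hb
    exact (Submodule.Quotient.mk_eq_zero _).1 hb
  have : IsNoetherian R (Submodule.span R {x}) :=
    isNoetherian_of_fg_of_noetherian _ (Submodule.fg_span_singleton _)
  obtain ⟨m, hm⟩ := exists_pow_le_annihilator_sup
    (Submodule.FG.of_le_of_isNoetherian (Submodule.smul_le_right : 𝔟 • Submodule.span R {x} ≤ _)) h𝔟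
  refine (Submodule.Quotient.mk_eq_zero _).2 (mem_torsion_of_le_annihilator (m := m + n)
    (𝔞 := (𝔟 • Submodule.span R {x}).annihilator * 𝔟) ?_ fun a ha => ?_)
  · rw [pow_add]
    exact (Ideal.mul_mono hm hn).trans (sup_mul_sup_le _ _ _)
  · rw [← Submodule.mem_annihilator_span_singleton]
    refine Ideal.mul_le.2 (fun a ha b hb => ?_) ha
    rw [Submodule.mem_annihilator_span_singleton, mul_smul]
    exact Submodule.mem_annihilator.1 ha _
      (Submodule.smul_mem_smul hb (Submodule.mem_span_singleton_self x))

/-- By Artin-Rees, a submodule `N` of a cyclic module `Rx` is disjoint from `Ann(N) ^ k x` for some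
`k`. -/
lemma exists_pow_smul_disjoint [IsNoetherianRing R] (x : M) (N : Submodule R M)
    (hN : N ≤ Submodule.span R {x}) :
    ∃ k : ℕ, Disjoint (N.annihilator ^ k • Submodule.span R {x}) N := by
  set Z := Submodule.span R {x}
  set 𝔞 := N.annihilator
  have : Module.Finite R Z := Module.Finite.iff_fg.2 (Submodule.fg_span_singleton x)
  obtain ⟨k, hk⟩ := Ideal.exists_pow_inf_eq_pow_smul 𝔞 (N.comap Z.subtype)
  refine ⟨k + 1, ?_⟩
  rw [Submodule.disjoint_def]
  intro y hy hyN
  have hyZ : y ∈ Z := hN hyN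
  have h1 : (⟨y, hyZ⟩ : Z) ∈ 𝔞 ^ (k + 1) • (⊤ : Submodule R Z) ⊓ N.comap Z.subtype := by
    refine ⟨?_, hyN⟩
    have e : 𝔞 ^ (k + 1) • Z = (𝔞 ^ (k + 1) • (⊤ : Submodule R Z)).map Z.subtype := by
      rw [Submodule.map_smul'', Submodule.map_top, Submodule.range_subtype]
    rw [e] at hy
    obtain ⟨w, hw, hwy⟩ := hy
    have : w = ⟨y, hyZ⟩ := Subtype.ext hwy
    rwa [← this]
  rw [hk (k + 1) (Nat.le_succ k), Nat.add_sub_cancel_left, pow_one] at h1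
  -- Artin-Rees has split off one factor `𝔞`, which kills `N`.
  have h2 : 𝔞 • (𝔞 ^ k • (⊤ : Submodule R Z) ⊓ N.comap Z.subtype) ≤ ⊥ := by
    refine Submodule.smul_le.2 fun a ha w hw => ?_
    exact (Submodule.mem_bot R).2 (Subtype.ext (Submodule.mem_annihilator.1 ha _ hw.2))
  exact congrArg Subtype.val ((Submodule.mem_bot R).1 (h2 h1))

end Torsion

variable {R₀ R : Type u} [CommRing R₀] [CommRing R] [Algebra R₀ R] {𝒜 : ℕ → Submodule R₀ R}

/-! ### Homogeneous submodules, and injectivity of the torsion of an injective module -/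

namespace GrMod

/-- A submodule is homogeneous if it contains the components of its elements. -/
def IsHomog (X : GrMod 𝒜) (N : Submodule R X) : Prop := ∀ x ∈ N, ∀ n, X.proj n x ∈ N

variable {X Y : GrMod 𝒜}

lemma IsHomog.inf {N N' : Submodule R X} (h : X.IsHomog N) (h' : X.IsHomog N') :
    X.IsHomog (N ⊓ N') := fun x hx n => ⟨h x hx.1 n, h' x hx.2 n⟩

lemma IsHomog.sup {N N' : Submodule R X} (h : X.IsHomog N) (h' : X.IsHomog N') :
    X.IsHomog (N ⊔ N') := by
  intro x hx n
  obtain ⟨y, hy, z, hz, rfl⟩ := Submodule.mem_sup.1 hx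
  rw [map_add]
  exact Submodule.add_mem_sup (h y hy n) (h' z hz n)

lemma IsHomog.map {N : Submodule R X} (h : X.IsHomog N) (f : X ⟶ Y) :
    Y.IsHomog (N.map f.toLin) := by
  rintro _ ⟨x, hx, rfl⟩ n
  exact ⟨X.proj n x, h x hx n, Hom.map_proj f n x⟩

variable (X) in
/-- A homogeneous submodule maximal among those disjoint from a given submodule. -/
lemma exists_maximal_disjoint (T : Submodule R X) :
    ∃ H : Submodule R X, Maximal (fun H => X.IsHomog H ∧ Disjoint H T) H := by
  have hchain : ∀ c ⊆ {H : Submodule R X | X.IsHomog H ∧ Disjoint H T}, IsChain (· ≤ ·) c →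
      ∀ y ∈ c, ∃ ub ∈ {H : Submodule R X | X.IsHomog H ∧ Disjoint H T}, ∀ z ∈ c, z ≤ ub := by
    refine fun c hc hch y hy => ⟨sSup c, ⟨fun x hx n => ?_, ?_⟩, fun z hz => le_sSup hz⟩
    · obtain ⟨N, hN, hxN⟩ := (Submodule.mem_sSup_of_directed ⟨y, hy⟩ hch.directedOn).1 hx
      exact (le_sSup hN : N ≤ sSup c) ((hc hN).1 x hxN n)
    · rw [Submodule.disjoint_def]
      intro x hx hxT
      obtain ⟨N, hN, hxN⟩ := (Submodule.mem_sSup_of_directed ⟨y, hy⟩ hch.directedOn).1 hx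
      exact Submodule.disjoint_def.1 (hc hN).2 x hxN hxT
  obtain ⟨H, -, hH⟩ := zorn_le_nonempty₀ _ hchain ⊥ ⟨fun x hx n => by
    rw [(Submodule.mem_bot R).1 hx, map_zero]; exact zero_mem _, disjoint_bot_left⟩
  exact ⟨H, hH⟩

variable [GradedAlgebra 𝒜]

lemma isHomog_span_singleton {n : ℤ} {x : X} (hx : x ∈ X.deg n) :
    X.IsHomog (Submodule.span R {x}) := by
  classical
  intro y hy m
  obtain ⟨a, rfl⟩ := Submodule.mem_span_singleton.1 hy
  rw [← DirectSum.sum_support_decompose 𝒜 a, Finset.sum_smul, map_sum]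
  refine Submodule.sum_mem _ fun k _ => ?_
  rw [proj_smul X (Submodule.coe_mem _)]
  by_cases h : n = m - k
  · rw [← h, X.proj_same hx]
    exact Submodule.smul_mem _ _ (Submodule.mem_span_singleton_self x)
  · rw [X.proj_ne h hx, smul_zero]
    exact zero_mem _

/-- If `a` kills the homogeneous element `X.proj n x`, the component of degree `m + n` of the
product shows that the degree `m` part of `a` kills it too. -/
lemma isHomogeneous_annihilator {N : Submodule R X} (h : X.IsHomog N) :
    N.annihilator.IsHomogeneous 𝒜 := by
  classical
  intro m a ha
  rw [Submodule.mem_annihilator]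
  intro x hx
  have key : ∀ n, ((DirectSum.decompose 𝒜 a m : 𝒜 m) : R) • X.proj n x = 0 := by
    intro n
    have h0 := congrArg (X.proj (m + n)) (Submodule.mem_annihilator.1 ha _ (h x hx n))
    rw [← DirectSum.sum_support_decompose 𝒜 a, Finset.sum_smul, map_sum, map_zero] at h0
    by_cases hm : m ∈ (DirectSum.decompose 𝒜 a).support
    · rw [Finset.sum_eq_single_of_mem m hm, proj_smul X (Submodule.coe_mem _),
        add_sub_cancel_left, X.proj_same (X.proj_mem n x)] at h0
      · exact h0
      · intro k _ hk
        rw [proj_smul X (Submodule.coe_mem _), X.proj_ne (by omega) (X.proj_mem n x), smul_zero]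
    · rw [DFinsupp.notMem_support_iff.1 hm]
      simp
  obtain ⟨s, hs, -⟩ := X.exists_eq_sum x
  rw [hs, Finset.smul_sum]
  exact Finset.sum_eq_zero fun n _ => key n

lemma isHomogeneous_pow {𝔞 : Ideal R} (h : 𝔞.IsHomogeneous 𝒜) (n : ℕ) :
    (𝔞 ^ n).IsHomogeneous 𝒜 := by
  induction n with
  | zero => rw [pow_zero, Ideal.one_eq_top]; exact Ideal.IsHomogeneous.top 𝒜
  | succ n ih => rw [pow_succ]; exact ih.mul h

variable [IsNoetherianRing R] (I J : HomogeneousIdeal 𝒜)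

/-- Modulo a maximal homogeneous submodule disjoint from the torsion, everything is torsion. -/
lemma mem_torsion_quot_of_maximal {H : Submodule R X}
    (hH : Maximal (fun H => X.IsHomog H ∧ Disjoint H (torsion X I.toIdeal J.toIdeal)) H) (y : X) :
    H.mkQ y ∈ torsion (X ⧸ H) I.toIdeal J.toIdeal := by
  classical
  set T := torsion X I.toIdeal J.toIdeal
  suffices h : ∀ n, ∀ x ∈ X.deg n, H.mkQ x ∈ torsion (X ⧸ H) I.toIdeal J.toIdeal by
    obtain ⟨s, hs, -⟩ := X.exists_eq_sum y
    rw [hs, map_sum]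
    exact Submodule.sum_mem _ fun n _ => h n _ (X.proj_mem n y)
  intro n x hx
  let π : X ⟶ X.quot H hH.prop.1 := X.quotπ H hH.prop.1
  -- `N` is the part of the cyclic module generated by the class of `x` that comes from torsion.
  -- With `𝔞 = Ann N`, a power of `I` lies in `𝔞 + J`, so it suffices that a power of `𝔞` kills the
  -- class of `x`.
  let N : Submodule R (X.quot H hH.prop.1) := Submodule.span R {π.toLin x} ⊓ T.map π.toLin
  have hN : (X.quot H hH.prop.1).IsHomog N :=
    (isHomog_span_singleton (π.map_deg hx)).inf
      (IsHomog.map (fun x hx n => proj_mem_torsion X I J x hx n) π)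
  have hNT : N ≤ torsion (X.quot H hH.prop.1) I.toIdeal J.toIdeal := by
    rintro _ ⟨-, t, ht, rfl⟩
    exact map_mem_torsion _ _ π.toLin ht
  have hNfg : N.FG := by
    have : IsNoetherian R (Submodule.span R {π.toLin x}) :=
      isNoetherian_of_fg_of_noetherian _ (Submodule.fg_span_singleton _)
    exact Submodule.FG.of_le_of_isNoetherian inf_le_left
  obtain ⟨m, hm⟩ := exists_pow_le_annihilator_sup hNfg hNT
  obtain ⟨k, hk⟩ := exists_pow_smul_disjoint (π.toLin x) N inf_le_left
  set 𝔞 := N.annihilator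
  have hker : ∀ z, π.toLin z = 0 ↔ z ∈ H := fun z => Submodule.Quotient.mk_eq_zero H
  have hH' : X.IsHomog (H ⊔ 𝔞 ^ k • Submodule.span R {x}) :=
    hH.prop.1.sup fun z hz n => proj_mem_smul X _ (isHomogeneous_pow
      (isHomogeneous_annihilator hN) k) _ (isHomog_span_singleton hx) z hz n
  -- A torsion element `h + w` of the enlarged submodule has its image in both `N` and `𝔞 ^ k •
  -- Submodule.span R {π.toLin x}`, hence lies in `H` and vanishes. Maximality of `H` then puts `𝔞 ^
  -- k x` inside `H`.
  have hdisj : Disjoint (H ⊔ 𝔞 ^ k • Submodule.span R {x}) T := by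
    rw [Submodule.disjoint_def]
    intro t ht htT
    obtain ⟨h, hh, w, hw, rfl⟩ := Submodule.mem_sup.1 ht
    have h1 : π.toLin (h + w) = π.toLin w := by rw [map_add, (hker h).2 hh, zero_add]
    have h2 : π.toLin w ∈ 𝔞 ^ k • Submodule.span R {π.toLin x} := by
      have := Submodule.mem_map_of_mem (f := π.toLin) hw
      rwa [Submodule.map_smul'', Submodule.map_span, Set.image_singleton] at this
    have h3 : π.toLin w ∈ N :=
      ⟨Submodule.smul_le_right h2, h1 ▸ Submodule.mem_map_of_mem htT⟩
    have h4 := (hker w).1 (Submodule.disjoint_def.1 hk _ h2 h3)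
    exact Submodule.disjoint_def.1 hH.prop.2 _ (add_mem hh h4) htT
  have hle : 𝔞 ^ k • Submodule.span R {x} ≤ H :=
    le_sup_right.trans (hH.2 ⟨hH', hdisj⟩ le_sup_left)
  refine mem_torsion_of_le_annihilator (m := m * k) (𝔞 := 𝔞 ^ k) ?_ fun a ha => ?_
  · rw [pow_mul]
    exact (Ideal.pow_right_mono hm k).trans (sup_pow_le _ _ k)
  · rw [← map_smul]
    exact (hker _).2 (hle (Submodule.smul_mem_smul ha (Submodule.mem_span_singleton_self x)))

/-- The torsion submodule of an injective graded module is injective. -/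
lemma injective_torsionFunctor_obj (E : GrMod 𝒜) [hE : Injective E] :
    Injective ((torsionFunctor I J).obj E) := by
  obtain ⟨H, hH⟩ := exists_maximal_disjoint E (torsion E I.toIdeal J.toIdeal)
  let i : (torsionFunctor I J).obj E ⟶ E := E.subι _ (proj_mem_torsion E I J)
  let π : E ⟶ E.quot H hH.prop.1 := E.quotπ H hH.prop.1
  have : Mono (i ≫ π) := by
    refine mono_of_injective _ ((injective_iff_map_eq_zero _).2 fun x hx => Subtype.ext ?_)
    exact Submodule.disjoint_def.1 hH.prop.2 _ ((Submodule.Quotient.mk_eq_zero H).1 hx) x.2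
  -- Injectivity of `E` extends the inclusion of the torsion along its embedding into `E/H`. As
  -- `E/H` is torsion, `φ` lands in the torsion of `E`, which makes `π ≫ φ` a retraction.
  obtain ⟨φ, hφ⟩ := hE.factors i (i ≫ π)
  let r : E ⟶ (torsionFunctor I J).obj E :=
    ⟨(π ≫ φ).toLin.codRestrict _ fun y =>
      map_mem_torsion _ _ φ.toLin (mem_torsion_quot_of_maximal I J hH y),
      fun h => (π ≫ φ).map_deg h⟩
  refine Retract.injective (Y := E) ⟨i, r, ?_⟩
  ext x
  exact Subtype.ext (toLin_apply_of_eq hφ x)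

end GrMod

end

/-! ### Formal properties of local cohomology -/

section

variable {R₀ R : Type u} [CommRing R₀] [CommRing R] [Algebra R₀ R] {𝒜 : ℕ → Submodule R₀ R}
  [GradedAlgebra 𝒜] [IsNoetherianRing R] (I J : HomogeneousIdeal 𝒜)

open GrMod

/-- Left exactness, which identifies the zeroth derived functor with the torsion functor. Torsion is
reflected by injective maps, so a preimage of a torsion element under `S.f` is torsion. -/
instance : PreservesFiniteLimits (torsionFunctor I J) := by
  refine ((Functor.preservesFiniteLimits_tfae (torsionFunctor I J)).out 0 3).1 fun S hS => ?_
  obtain ⟨hf, hfg, -⟩ := (shortExact_iff S).1 hS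
  refine ⟨(exact_iff _).2 fun y => ⟨fun hy => ?_, ?_⟩,
    mono_of_injective _ fun x y hxy => Subtype.ext (hf (congrArg Subtype.val hxy))⟩
  · obtain ⟨x, hx⟩ := (hfg y.1).1 (congrArg Subtype.val hy)
    exact ⟨⟨x, mem_torsion_of_injective S.f.toLin hf (hx ▸ y.2)⟩, Subtype.ext hx⟩
  · rintro ⟨x, rfl⟩
    exact Subtype.ext (hfg.apply_apply_eq_zero x.1)

/-- Local cohomology in degree zero is the torsion functor. -/
noncomputable def localCohomologyZeroIso (X : GrMod 𝒜) :
    localCohomology I J 0 X ≅ (torsionFunctor I J).obj X :=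
  (Functor.rightDerivedZeroIsoSelf (torsionFunctor I J)).app X

/-- The long exact sequence of local cohomology. -/
lemma localCohomology_exact {S : ShortComplex (GrMod 𝒜)} (hS : S.ShortExact) (k : ℕ) :
    ∃ (δ : localCohomology I J k S.X₃ ⟶ localCohomology I J (k + 1) S.X₁)
      (f : localCohomology I J k S.X₁ ⟶ localCohomology I J k S.X₂)
      (g : localCohomology I J k S.X₂ ⟶ localCohomology I J k S.X₃)
      (f' : localCohomology I J (k + 1) S.X₁ ⟶ localCohomology I J (k + 1) S.X₂),
      -- Identifying `g` matters in the base case of the vanishing for torsion modules, where its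
      -- surjectivity is read off from the torsion functor.
      g = ((torsionFunctor I J).rightDerived k).map S.g ∧
      Function.Exact f.toLin g.toLin ∧ Function.Exact g.toLin δ.toLin ∧
      Function.Exact δ.toLin f'.toLin := by
  obtain ⟨δ, ⟨w₁, h₁⟩, ⟨w₂, h₂⟩, ⟨w₃, h₃⟩⟩ := (torsionFunctor I J).rightDerived_exact hS k
  exact ⟨δ, _, _, _, rfl, (exact_iff _).1 h₁, (exact_iff _).1 h₂, (exact_iff _).1 h₃⟩

variable {I J} in
lemma subsingleton_localCohomology_injective (X : GrMod 𝒜) [Injective X] (k : ℕ) :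
    Subsingleton (localCohomology I J (k + 1) X) :=
  (isZero_iff _).1 ((torsionFunctor I J).isZero_rightDerived_obj_injective_succ k X)

/-- A graded torsion module embeds into an injective one with torsion cokernel. -/
lemma exists_shortExact_of_torsion (X : GrMod 𝒜) (hX : torsion X I.toIdeal J.toIdeal = ⊤) :
    ∃ (G C : GrMod 𝒜) (f : X ⟶ G) (g : G ⟶ C) (w : f ≫ g = 0),
      (ShortComplex.mk f g w).ShortExact ∧ Injective G ∧
      torsion G I.toIdeal J.toIdeal = ⊤ ∧ torsion C I.toIdeal J.toIdeal = ⊤ := by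
  let G := (torsionFunctor I J).obj (Injective.under X)
  let j : X ⟶ G := ⟨(Injective.ι X).toLin.codRestrict _ fun x =>
    map_mem_torsion _ _ _ (hX ▸ Submodule.mem_top : x ∈ torsion X I.toIdeal J.toIdeal),
    fun h => (Injective.ι X).map_deg h⟩
  have hj : Function.Injective j.toLin := fun x y hxy =>
    injective_of_mono (Injective.ι X) (congrArg Subtype.val hxy)
  have hGt (y : G) : y ∈ torsion G I.toIdeal J.toIdeal :=
    mem_torsion_of_injective (Submodule.subtype _) Subtype.val_injective y.2
  refine ⟨G, _, j, G.quotπ _ (range_homogeneous j),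
    by ext x; exact (Submodule.Quotient.mk_eq_zero _).2 ⟨x, rfl⟩, (shortExact_iff _).2
      ⟨hj, fun y => Submodule.Quotient.mk_eq_zero _, Submodule.mkQ_surjective _⟩,
    injective_torsionFunctor_obj I J _, eq_top_iff.2 fun y _ => hGt y, eq_top_iff.2 fun y _ => ?_⟩
  obtain ⟨x, rfl⟩ := Submodule.mkQ_surjective _ y
  exact map_mem_torsion _ _ _ (hGt x)

/-- A graded torsion module has no higher local cohomology. -/
lemma subsingleton_localCohomology_of_torsion (k : ℕ) (X : GrMod 𝒜)
    (hX : torsion X I.toIdeal J.toIdeal = ⊤) : Subsingleton (localCohomology I J (k + 1) X) := by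
  induction k generalizing X with
  | zero =>
    obtain ⟨G, C, j, q, w, hS, hG, hGt, hCt⟩ := exists_shortExact_of_torsion I J X hX
    obtain ⟨δ, f, g, f', hg, -, h₂, h₃⟩ := localCohomology_exact I J hS 0
    -- On modules that are entirely torsion, the torsion functor changes nothing, so `q` stays
    -- surjective and the connecting map `δ` vanishes.
    have hg' : Function.Surjective g.toLin := by
      have : Epi ((torsionFunctor I J).map q) := by
        refine epi_of_surjective _ fun y => ?_
        obtain ⟨x, hx⟩ := ((shortExact_iff _).1 hS).2.2 y.1
        exact ⟨⟨x, hGt ▸ Submodule.mem_top⟩, Subtype.ext hx⟩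
      have : Epi (((torsionFunctor I J).rightDerived 0).map q) := by
        rw [← NatIso.naturality_2 (Functor.rightDerivedZeroIsoSelf (torsionFunctor I J)) q]
        infer_instance
      rw [hg]
      exact surjective_of_epi (((torsionFunctor I J).rightDerived 0).map q)
    have := subsingleton_localCohomology_injective (I := I) (J := J) G 0
    have hz : ∀ x : localCohomology I J (0 + 1) X, x = 0 := fun x => by
      obtain ⟨y, rfl⟩ := (h₃ x).1 (Subsingleton.elim _ _)
      exact (h₂ y).2 (hg' y)
    exact ⟨fun x y => (hz x).trans (hz y).symm⟩
  | succ k ih =>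
    obtain ⟨G, C, j, q, w, hS, hG, hGt, hCt⟩ := exists_shortExact_of_torsion I J X hX
    obtain ⟨δ, f, g, f', -, -, -, h₃⟩ := localCohomology_exact I J hS (k + 1)
    have := subsingleton_localCohomology_injective (I := I) (J := J) G (k + 1)
    have := ih C hCt
    have hz : ∀ x : localCohomology I J (k + 1 + 1) X, x = 0 := fun x => by
      obtain ⟨y, rfl⟩ := (h₃ x).1 (Subsingleton.elim _ _)
      exact (congrArg _ (Subsingleton.elim y 0)).trans (map_zero _)
    exact ⟨fun x y => (hz x).trans (hz y).symm⟩

/-- Local cohomology commutes with shifts. -/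
lemma nonempty_localCohomology_shift_iso (k : ℤ) (j : ℕ) (X : GrMod 𝒜) :
    Nonempty (localCohomology I J j (X.shift k) ≅ (localCohomology I J j X).shift k) :=
  (torsionFunctor I J).rightDerived_obj_iso_of_exact (GrMod.shiftFunctor 𝒜 k)
    (GrMod.shiftFunctor 𝒜 k)
    (NatIso.ofComponents (fun _ =>
      { hom := ⟨LinearMap.id, fun h => h⟩
        inv := ⟨LinearMap.id, fun h => h⟩
        hom_inv_id := rfl
        inv_hom_id := rfl }) fun _ => rfl) j X

/-- The quotient of a graded module by its torsion. -/
noncomputable def torsionFree (X : GrMod 𝒜) : GrMod 𝒜 :=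
  X.quot (torsion X I.toIdeal J.toIdeal) (proj_mem_torsion X I J)

lemma torsion_torsionFree (X : GrMod 𝒜) :
    torsion (torsionFree I J X) I.toIdeal J.toIdeal = ⊥ := torsion_quotient_torsion

instance (X : GrMod 𝒜) [Module.Finite R X] : Module.Finite R (torsionFree I J X) :=
  Module.Finite.of_surjective (Submodule.mkQ (torsion X I.toIdeal J.toIdeal))
    (Submodule.mkQ_surjective _)

lemma subsingleton_localCohomology_zero_torsionFree (X : GrMod 𝒜) :
    Subsingleton (localCohomology I J 0 (torsionFree I J X)) := by
  have : Subsingleton ((torsionFunctor I J).obj (torsionFree I J X)) :=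
    Submodule.subsingleton_iff_eq_bot.2 (torsion_torsionFree I J X)
  exact (isoLinearEquiv (localCohomologyZeroIso I J (torsionFree I J X))).toEquiv.subsingleton

/-- In the long exact sequence, both neighbours are higher local cohomology of the torsion submodule
and vanish. -/
lemma nonempty_localCohomology_torsionFree_iso (X : GrMod 𝒜) (k : ℕ) :
    Nonempty (localCohomology I J (k + 1) X ≅ localCohomology I J (k + 1) (torsionFree I J X)) := by
  let S : ShortComplex (GrMod 𝒜) := ShortComplex.mk (X.subι _ (proj_mem_torsion X I J))
    (X.quotπ _ (proj_mem_torsion X I J))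
    (by ext x; exact (Submodule.Quotient.mk_eq_zero _).2 x.2)
  have hS : S.ShortExact := (shortExact_iff S).2 ⟨Subtype.val_injective, fun y =>
    (Submodule.Quotient.mk_eq_zero _).trans ⟨fun h => ⟨⟨y, h⟩, rfl⟩, by rintro ⟨x, rfl⟩; exact x.2⟩,
    Submodule.mkQ_surjective _⟩
  have hT (k) : Subsingleton (localCohomology I J (k + 1) S.X₁) :=
    subsingleton_localCohomology_of_torsion I J k _ (eq_top_iff.2 fun y _ =>
      mem_torsion_of_injective (Submodule.subtype _) Subtype.val_injective y.2)
  obtain ⟨δ, f, g, f', -, h₁, h₂, -⟩ := localCohomology_exact I J hS (k + 1)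
  have := hT k
  have := hT (k + 1)
  have : Mono g := mono_of_injective _ ((injective_iff_map_eq_zero _).2 fun x hx => by
    obtain ⟨y, rfl⟩ := (h₁ x).1 hx
    exact (congrArg _ (Subsingleton.elim y 0)).trans (map_zero _))
  have : Epi g := epi_of_surjective _ fun y => (h₂ y).1 (Subsingleton.elim _ _)
  have : IsIso g := isIso_of_mono_of_epi g
  exact ⟨@asIso _ _ _ _ g this⟩

end

section

/-! ### Finiteness of associated primes, and avoidance of submodules -/

section AssociatedPrimes

variable {A : Type u} [CommRing A]

/-- All quotients of `N` by finitely generated submodules have finitely many associated primes. -/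
def HasFiniteAssQuotients (A : Type u) [CommRing A] (N : Type u) [AddCommGroup N] [Module A N] :
    Prop :=
  ∀ F : Submodule A N, F.FG → (associatedPrimes A (N ⧸ F)).Finite

variable {N₁ N₂ N₃ N₄ : Type u} [AddCommGroup N₁] [Module A N₁] [AddCommGroup N₂] [Module A N₂]
  [AddCommGroup N₃] [Module A N₃] [AddCommGroup N₄] [Module A N₄]

lemma HasFiniteAssQuotients.finite_associatedPrimes (h : HasFiniteAssQuotients A N₁) :
    (associatedPrimes A N₁).Finite := by
  rw [← LinearEquiv.AssociatedPrimes.eq (Submodule.quotEquivOfEqBot (⊥ : Submodule A N₁) rfl)]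
  exact h ⊥ Submodule.fg_bot

/-- Proper submodules of a finite module over a local ring with infinite residue field do not
cover it. -/
lemma exists_notMem_of_infinite_residueField [IsLocalRing A] [Infinite (IsLocalRing.ResidueField A)]
    [Module.Finite A N₁] {ι : Type*} (s : Finset ι) (p : ι → Submodule A N₁)
    (hp : ∀ i ∈ s, p i ≠ ⊤) : ∃ x, ∀ i ∈ s, x ∉ p i := by
  by_contra! hcov
  -- By B. H. Neumann's covering lemma, one of the submodules has finite index. A maximal submodule
  -- above it has the residue field as its quotient, which would then be finite.
  obtain ⟨k, hk, hfi⟩ := Submodule.exists_finiteIndex_of_cover (s := s) (p := p)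
    (Set.eq_univ_of_forall fun x => by simpa using hcov x)
  have : Finite (N₁ ⧸ p k) := AddSubgroup.finite_quotient_of_finiteIndex
  obtain ⟨q, hq, hkq⟩ := (eq_top_or_exists_le_coatom (p k)).resolve_left (hp k hk)
  have : Finite (N₁ ⧸ q) := Finite.of_surjective _ (Submodule.factor_surjective hkq)
  have : IsSimpleModule A (N₁ ⧸ q) := isSimpleModule_iff_isCoatom.2 hq
  obtain ⟨I, hI, ⟨e⟩⟩ := isSimpleModule_iff_quot_maximal.1 this
  rw [IsLocalRing.eq_maximalIdeal hI] at e
  have : Finite (IsLocalRing.ResidueField A) := Finite.of_equiv _ e.toEquiv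
  exact not_finite (IsLocalRing.ResidueField A)

variable [IsNoetherianRing A]

variable (A N₁) in
lemma hasFiniteAssQuotients_of_finite [Module.Finite A N₁] : HasFiniteAssQuotients A N₁ :=
  fun F _ => associatedPrimes.finite A (N₁ ⧸ F)

/-- For `F` finitely generated in `N₃`, the preimage `g⁻¹(F)` is an extension of a submodule of `F`
by the image of the finite module `N₁`, so it is finitely generated. Then `N₂/g⁻¹(F) → N₃/F →
N₄/h(F)` is exact with injective first map. -/
lemma HasFiniteAssQuotients.of_exact {f : N₁ →ₗ[A] N₂} {g : N₂ →ₗ[A] N₃} {h : N₃ →ₗ[A] N₄}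
    (hfg : Function.Exact f g) (hgh : Function.Exact g h) [Module.Finite A N₁]
    (h₂ : HasFiniteAssQuotients A N₂) (h₄ : HasFiniteAssQuotients A N₄) :
    HasFiniteAssQuotients A N₃ := by
  intro F hF
  have hF' : (F.comap g).FG := by
    refine Submodule.fg_of_fg_map_of_fg_inf_ker g ?_ ?_
    · have : IsNoetherian A F := isNoetherian_of_fg_of_noetherian _ hF
      exact Submodule.FG.of_le_of_isNoetherian (Submodule.map_comap_le g F)
    · have hr : LinearMap.ker g = LinearMap.range f := LinearMap.exact_iff.1 hfg
      have : IsNoetherian A (LinearMap.range f) :=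
        isNoetherian_of_fg_of_noetherian _
          (by rw [LinearMap.range_eq_map]; exact Module.Finite.fg_top.map f)
      exact Submodule.FG.of_le_of_isNoetherian (inf_le_right.trans hr.le)
  refine ((h₂ _ hF').union (h₄ _ (hF.map h))).subset (associatedPrimes.subset_union_of_exact
    (f := (F.comap g).mapQ F g le_rfl) (g := F.mapQ (F.map h) h (Submodule.le_comap_map h F)) ?_ ?_)
  · rw [← LinearMap.ker_eq_bot, Submodule.ker_mapQ, Submodule.mkQ_map_self]
  · intro y
    obtain ⟨y, rfl⟩ := F.mkQ_surjective y
    constructor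
    · intro hy
      obtain ⟨z, hz, hzy⟩ := (Submodule.Quotient.mk_eq_zero _).1 hy
      obtain ⟨x, hx⟩ := (hgh (y - z)).1 (by rw [map_sub, hzy, sub_self])
      refine ⟨(F.comap g).mkQ x, ?_⟩
      change F.mkQ (g x) = F.mkQ y
      have hz' : F.mkQ z = 0 := (Submodule.Quotient.mk_eq_zero F).2 hz
      rw [hx, map_sub, hz', sub_zero]
    · rintro ⟨x, hx⟩
      obtain ⟨x, rfl⟩ := Submodule.mkQ_surjective _ x
      rw [← hx]
      change (F.map h).mkQ (h (g x)) = 0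
      rw [hgh.apply_apply_eq_zero, map_zero]

lemma HasFiniteAssQuotients.of_equiv (e : N₁ ≃ₗ[A] N₂) (h : HasFiniteAssQuotients A N₁) :
    HasFiniteAssQuotients A N₂ :=
  HasFiniteAssQuotients.of_exact (f := (0 : PUnit.{u + 1} →ₗ[A] N₁)) (g := e.toLinearMap)
    (h := (0 : N₂ →ₗ[A] PUnit.{u + 1}))
    ((LinearMap.exact_zero_iff_injective _ _).2 e.injective)
    ((LinearMap.exact_zero_iff_surjective _ _).2 e.surjective) h
    (hasFiniteAssQuotients_of_finite A _)

end AssociatedPrimes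

variable {R₀ R : Type u} [CommRing R₀] [CommRing R] [Algebra R₀ R] {𝒜 : ℕ → Submodule R₀ R}

/-! ### Finite graded modules: components and regular elements of degree one -/

namespace GrMod

variable [GradedAlgebra 𝒜] (X : GrMod 𝒜)

lemma proj_smul_eq_sum (a : R) (x : X) (n : ℤ) [∀ (i : ℕ) (x : 𝒜 i), Decidable (x ≠ 0)] :
    X.proj n (a • x) = ∑ m ∈ (DirectSum.decompose 𝒜 a).support,
      ((DirectSum.decompose 𝒜 a m : 𝒜 m) : R) • X.proj (n - m) x := by
  conv_lhs => rw [← DirectSum.sum_support_decompose 𝒜 a, Finset.sum_smul, map_sum]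
  exact Finset.sum_congr rfl fun m _ => proj_smul X (Submodule.coe_mem _) n x

/-- A finite graded module is bounded below. -/
lemma exists_deg_eq_bot [Module.Finite R X] : ∃ n₀ : ℤ, ∀ n ≤ n₀, X.deg n = ⊥ := by
  classical
  have key : ∀ N : Submodule R X, N.FG → ∃ n₀ : ℤ, ∀ x ∈ N, ∀ n ≤ n₀, X.proj n x = 0 := by
    intro N hN
    induction N, hN using Submodule.fg_induction with
    | singleton x =>
      obtain ⟨s, -, hs⟩ := X.exists_eq_sum x
      obtain ⟨d, hd⟩ := s.bddBelow
      -- `d` bounds the degrees of the components of `x` from below, and multiplication by ring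
      -- elements never lowers degrees.
      refine ⟨d - 1, fun y hy n hn => ?_⟩
      obtain ⟨a, rfl⟩ := Submodule.mem_span_singleton.1 hy
      rw [proj_smul_eq_sum]
      refine Finset.sum_eq_zero fun m _ => ?_
      rw [hs, smul_zero]
      intro h
      have := hd h
      omega
    | sup N₁ N₂ _ _ h₁ h₂ =>
      obtain ⟨d₁, h₁⟩ := h₁
      obtain ⟨d₂, h₂⟩ := h₂
      refine ⟨min d₁ d₂, fun x hx n hn => ?_⟩
      obtain ⟨y, hy, z, hz, rfl⟩ := Submodule.mem_sup.1 hx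
      rw [map_add, h₁ y hy n (hn.trans (min_le_left _ _)),
        h₂ z hz n (hn.trans (min_le_right _ _)), add_zero]
  obtain ⟨n₀, h⟩ := key ⊤ Module.Finite.fg_top
  refine ⟨n₀, fun n hn => eq_bot_iff.2 fun x hx => ?_⟩
  rw [Submodule.mem_bot, ← X.proj_same hx, h x trivial n hn]

/-- The submodule generated by elements of degree `n` contains no further such elements. -/
lemma proj_mem_of_mem_span (h𝒜 : ∀ a ∈ 𝒜 0, a ∈ (algebraMap R₀ R).range) {n : ℤ}
    (N : Submodule R₀ X) (hN : N ≤ X.deg n) {x : X} (hx : x ∈ Submodule.span R (N : Set X)) :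
    X.proj n x ∈ N := by
  classical
  -- Vanishing below degree `n` must be carried along: with it, only the degree zero part of a
  -- scalar, which comes from `R₀`, contributes in degree `n`.
  suffices h : X.proj n x ∈ N ∧ ∀ k < n, X.proj k x = 0 from h.1
  induction hx using Submodule.span_induction with
  | zero => simp
  | mem y hy =>
    exact ⟨by rwa [X.proj_same (hN hy)], fun k hk => X.proj_ne hk.ne' (hN hy)⟩
  | add y z _ _ hy hz =>
    refine ⟨by rw [map_add]; exact add_mem hy.1 hz.1, fun k hk => ?_⟩
    rw [map_add, hy.2 k hk, hz.2 k hk, add_zero]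
  | smul a y _ hy =>
    refine ⟨?_, fun k hk => ?_⟩
    · rw [proj_smul_eq_sum]
      refine Submodule.sum_mem _ fun m _ => ?_
      rcases m.eq_zero_or_pos with rfl | hm
      · obtain ⟨r, hr⟩ := h𝒜 _ (DirectSum.decompose 𝒜 a 0).2
        rw [← hr, algebraMap_smul, Nat.cast_zero, sub_zero]
        exact N.smul_mem r hy.1
      · rw [hy.2 _ (by omega), smul_zero]
        exact zero_mem _
    · rw [proj_smul_eq_sum]
      exact Finset.sum_eq_zero fun m _ => by rw [hy.2 _ (by omega), smul_zero]

/-- The components of a Noetherian graded module are Noetherian. -/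
lemma isNoetherian_deg (h𝒜 : ∀ a ∈ 𝒜 0, a ∈ (algebraMap R₀ R).range) [IsNoetherian R X] (n : ℤ) :
    IsNoetherian R₀ (X.deg n) := by
  -- Generating an `R`-submodule embeds the order of `R₀`-submodules of the component into that of
  -- `R`-submodules of `X`, since `N` is recovered in degree `n`.
  let φ : Submodule R₀ (X.deg n) → Submodule R X := fun N =>
    Submodule.span R (N.map (X.deg n).subtype : Set X)
  have hφ : ∀ N N', φ N ≤ φ N' → N ≤ N' := by
    intro N N' h x hx
    have h1 : (x : X) ∈ φ N' := h (Submodule.subset_span ⟨x, hx, rfl⟩)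
    have h2 := proj_mem_of_mem_span X h𝒜 _ (Submodule.map_subtype_le _ N') h1
    rw [X.proj_same x.2] at h2
    obtain ⟨y, hy, hyx⟩ := h2
    rwa [← Subtype.ext hyx]
  have hmono : StrictMono φ := fun N N' h => lt_of_le_not_ge
    (Submodule.span_mono (Submodule.map_mono h.le)) fun h' => h.not_ge (hφ _ _ h')
  exact isNoetherian_iff'.2 hmono.wellFoundedGT

variable [IsNoetherianRing R]

lemma finite_deg (h𝒜 : IsStandardGraded 𝒜) [Module.Finite R X] (n : ℤ) :
    Module.Finite R₀ (X.deg n) := by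
  have := isNoetherian_deg X h𝒜.mem_range_of_degree_zero n
  infer_instance

/-- A finite graded module without torsion has a regular element of degree one. -/
lemma exists_regular [IsNoetherianRing R₀] [IsLocalRing R₀]
    [Infinite (IsLocalRing.ResidueField R₀)] (h𝒜 : IsStandardGraded 𝒜) (J : HomogeneousIdeal 𝒜)
    [Module.Finite R X]
    (hX : torsion X (HomogeneousIdeal.irrelevant 𝒜).toIdeal J.toIdeal = ⊥) :
    ∃ a ∈ 𝒜 1, ∀ x : X, a • x = 0 → x = 0 := by
  obtain ⟨S, hS, hgen⟩ := h𝒜.generated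
  have hirr : (HomogeneousIdeal.irrelevant 𝒜).toIdeal ≤ Ideal.span (S : Set R) := by
    have hle : Ideal.span (S : Set R) ≤ (HomogeneousIdeal.irrelevant 𝒜).toIdeal :=
      Ideal.span_le.2 fun a ha => HomogeneousIdeal.mem_irrelevant_of_mem 𝒜 one_pos (hS a ha)
    -- Modulo `S` every element is a constant; for elements of `R_+` that constant lies in degree
    -- zero and in `R_+`, so it is zero.
    have h : ∀ r : R, ∃ r₀ : R₀, r - algebraMap R₀ R r₀ ∈ Ideal.span (S : Set R) := by
      intro r
      have hr : r ∈ Algebra.adjoin R₀ (S : Set R) := hgen ▸ Algebra.mem_top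
      induction hr using Algebra.adjoin_induction with
      | mem x hx => exact ⟨0, by simpa using Ideal.subset_span hx⟩
      | algebraMap r => exact ⟨r, by simp⟩
      | add x y _ _ hx hy =>
        obtain ⟨p, hp⟩ := hx
        obtain ⟨q, hq⟩ := hy
        exact ⟨p + q, by convert add_mem hp hq using 1; rw [map_add]; ring⟩
      | mul x y _ _ hx hy =>
        obtain ⟨p, hp⟩ := hx
        obtain ⟨q, hq⟩ := hy
        refine ⟨p * q, ?_⟩
        convert add_mem (Ideal.mul_mem_right y _ hp)
          (Ideal.mul_mem_left _ (algebraMap R₀ R p) hq) using 1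
        rw [map_mul]
        ring
    intro r hr
    obtain ⟨r₀, h₀⟩ := h r
    have h1 : algebraMap R₀ R r₀ ∈ (HomogeneousIdeal.irrelevant 𝒜).toIdeal := by
      have := sub_mem hr (hle h₀)
      rwa [sub_sub_cancel] at this
    have h2 : algebraMap R₀ R r₀ = 0 := by
      have h3 := (HomogeneousIdeal.mem_irrelevant_iff 𝒜 _).1 h1
      rwa [GradedRing.proj_apply, DirectSum.decompose_of_mem_same 𝒜
        (SetLike.algebraMap_mem_graded 𝒜 r₀)] at h3
    rwa [h2, sub_zero] at h₀
  -- Avoidance takes place in this finite `R₀`-module of elements of degree one. An associated prime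
  -- containing it would contain `R_+`, and the element it annihilates would be torsion, hence zero.
  let N : Submodule R₀ R := Submodule.span R₀ (S : Set R)
  have : Module.Finite R₀ N := Module.Finite.iff_fg.2 (Submodule.fg_span S.finite_toSet)
  have hfin := associatedPrimes.finite R X
  obtain ⟨a, ha⟩ := exists_notMem_of_infinite_residueField (N₁ := N) hfin.toFinset
    (fun p => (p.restrictScalars R₀).comap N.subtype) (by
      intro p hp htop
      rw [Set.Finite.mem_toFinset, AssociatedPrimes.mem_iff, isAssociatedPrime_iff] at hp
      obtain ⟨hprime, x, hx⟩ := hp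
      have hSp : Ideal.span (S : Set R) ≤ p := Ideal.span_le.2 fun s hs => by
        have : (⟨s, Submodule.subset_span hs⟩ : N) ∈
          (p.restrictScalars R₀).comap N.subtype := htop ▸ Submodule.mem_top
        exact this
      have hxt : x ∈ torsion X (HomogeneousIdeal.irrelevant 𝒜).toIdeal J.toIdeal := by
        refine mem_torsion_of_le_annihilator (𝔞 := p) (m := 1) ?_ fun a ha => ?_
        · rw [pow_one]
          exact (hirr.trans hSp).trans le_sup_left
        · rw [hx, Submodule.mem_colon_singleton] at ha
          exact ha
      rw [hX, Submodule.mem_bot] at hxt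
      refine hprime.ne_top ?_
      rw [hx, hxt, eq_top_iff]
      intro r _
      rw [Submodule.mem_colon_singleton, smul_zero]
      exact zero_mem _)
  refine ⟨a, Submodule.span_le.2 hS a.2, fun x hx => ?_⟩
  by_contra hx0
  have : (a : R) ∈ ⋃ p ∈ associatedPrimes R X, (p : Set R) := by
    rw [biUnion_associatedPrimes_eq_zero_divisors]
    exact ⟨x, hx0, hx⟩
  obtain ⟨p, hp, hap⟩ := Set.mem_iUnion₂.1 this
  exact ha p (hfin.mem_toFinset.2 hp) hap

/-- Multiplication by an element of degree one. -/
def mulHom {a : R} (ha : a ∈ 𝒜 1) : X.shift (-1) ⟶ X :=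
  ⟨LinearMap.lsmul R X a, fun {n x} hx => by
    have := X.smul_mem ha (show x ∈ X.deg (n + -1) from hx)
    rwa [Nat.cast_one, add_comm n, add_neg_cancel_left] at this⟩

end GrMod

/-- A sequence of finite sets that decreases along `n → -∞`, up to a fixed set that its terms
contain, stabilizes. -/
lemma asymptoticallyStable_of_subset {S : ℤ → Set (Ideal R₀)} {T : Set (Ideal R₀)} (n₁ : ℤ)
    (hfin : ∀ n, (S n).Finite) (hT : ∀ n < n₁, T ⊆ S n)
    (hS : ∀ n ≤ n₁, S (n - 1) ⊆ T ∪ S n) : AsymptoticallyStable S := by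
  have hdec : ∀ n < n₁, S (n - 1) ⊆ S n := fun n hn =>
    (hS n hn.le).trans (Set.union_subset (hT n hn) le_rfl)
  have hanti : ∀ m : ℤ, m < n₁ → ∀ k : ℕ, S (m - k) ⊆ S m := by
    intro m hm k
    induction k with
    | zero => simp
    | succ k ih =>
      refine subset_trans ?_ ih
      have := hdec (m - k) (by omega)
      rwa [sub_sub] at this
  -- Below `n₁` the sets decrease; at an index of minimal cardinality they can shrink no further.
  obtain ⟨c, ⟨m, hm, hmc⟩, hmin⟩ := WellFounded.has_min (wellFounded_lt (α := ℕ))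
    {c | ∃ m < n₁, (S m).ncard = c} ⟨_, n₁ - 1, by omega, rfl⟩
  refine ⟨m, fun n hn => ?_⟩
  obtain ⟨k, rfl⟩ : ∃ k : ℕ, n = m - k := ⟨(m - n).toNat, by omega⟩
  refine Set.eq_of_subset_of_ncard_le (hanti m hm k) ?_ (hfin m)
  rw [hmc]
  exact not_lt.1 (hmin _ ⟨m - k, by omega, rfl⟩)

end

/-! ### The induction on the cohomological degree -/

section

open GrMod

variable {R₀ R : Type u} [CommRing R₀] [CommRing R] [Algebra R₀ R] {𝒜 : ℕ → Submodule R₀ R}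
  [GradedAlgebra 𝒜] [IsNoetherianRing R]

/-- The finiteness of local cohomology in low degrees passes to the quotient by torsion. -/
lemma finite_localCohomology_torsionFree (I J : HomogeneousIdeal 𝒜) (X : GrMod 𝒜) (i : ℕ)
    (h : ∀ j < i, Module.Finite R (localCohomology I J j X)) :
    ∀ j < i, Module.Finite R (localCohomology I J j (torsionFree I J X)) := by
  intro j hj
  cases j with
  | zero =>
    have := subsingleton_localCohomology_zero_torsionFree I J X
    infer_instance
  | succ j =>
    obtain ⟨e⟩ := nonempty_localCohomology_torsionFree_iso I J X j
    have := h _ hj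
    exact Module.Finite.equiv (isoLinearEquiv e)

lemma finite_localCohomology_zero (I J : HomogeneousIdeal 𝒜) (X : GrMod 𝒜) [Module.Finite R X] :
    Module.Finite R (localCohomology I J 0 X) :=
  have : Module.Finite R ((torsionFunctor I J).obj X) :=
    inferInstanceAs (Module.Finite R (torsion X I.toIdeal J.toIdeal))
  Module.Finite.equiv (isoLinearEquiv (localCohomologyZeroIso I J X)).symm

/-- The long exact sequence for multiplication by a regular element of degree one. -/
lemma localCohomology_exact_of_regular (I J : HomogeneousIdeal 𝒜) (X : GrMod 𝒜) {a : R}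
    (ha : a ∈ 𝒜 1) (hreg : ∀ x : X, a • x = 0 → x = 0) (k : ℕ) :
    ∃ (g : localCohomology I J k X ⟶
        localCohomology I J k (X.quot _ (range_homogeneous (X.mulHom ha))))
      (δ : localCohomology I J k (X.quot _ (range_homogeneous (X.mulHom ha))) ⟶
        (localCohomology I J (k + 1) X).shift (-1))
      (f : (localCohomology I J (k + 1) X).shift (-1) ⟶ localCohomology I J (k + 1) X),
      Function.Exact g.toLin δ.toLin ∧ Function.Exact δ.toLin f.toLin := by
  let S : ShortComplex (GrMod 𝒜) := ShortComplex.mk (X.mulHom ha)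
    (X.quotπ _ (range_homogeneous (X.mulHom ha)))
    (by ext x; exact (Submodule.Quotient.mk_eq_zero _).2 ⟨x, rfl⟩)
  have hS : S.ShortExact := (shortExact_iff S).2 ⟨(injective_iff_map_eq_zero _).2 hreg,
    fun y => Submodule.Quotient.mk_eq_zero _, Submodule.mkQ_surjective _⟩
  obtain ⟨δ, f, g, f', -, -, h₂, h₃⟩ := localCohomology_exact I J hS k
  -- The sequence involves the cohomology of `X.shift (-1)`; it is rewritten as shifted cohomology
  -- so that components of `X` in adjacent degrees are compared.
  obtain ⟨e⟩ := nonempty_localCohomology_shift_iso I J (-1) (k + 1) X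
  let E := isoLinearEquiv e
  refine ⟨g, δ ≫ e.hom, e.inv ≫ f', fun y => ?_, fun y => ?_⟩
  · refine (Iff.trans ?_ (h₂ y))
    exact E.map_eq_zero_iff
  · obtain ⟨z, rfl⟩ := E.surjective y
    have : (e.inv ≫ f').toLin (E z) = f'.toLin z := congrArg f'.toLin (E.symm_apply_apply z)
    rw [this, h₃ z]
    exact ⟨fun ⟨w, hw⟩ => ⟨w, congrArg E hw⟩, fun ⟨w, hw⟩ => ⟨w, E.injective hw⟩⟩

/-- The stability of associated primes, together with the finiteness statement needed to prove it
by induction. -/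
theorem asymptoticallyStable_and_hasFiniteAssQuotients [IsNoetherianRing R₀]
    [IsLocalRing R₀] [Infinite (IsLocalRing.ResidueField R₀)] (h𝒜 : IsStandardGraded 𝒜) (J : HomogeneousIdeal 𝒜)
    (hcond :
      (∀ N : GrMod 𝒜, Module.Finite R N → ∀ k : ℕ, ∃ n₀ : ℤ, ∀ n ≥ n₀,
        (localCohomology (HomogeneousIdeal.irrelevant 𝒜) J k N).deg n = ⊥) ∨
      (∀ N : GrMod 𝒜, Module.Finite R N → ∀ (k : ℕ) (n : ℤ), Module.Finite R₀
        ((localCohomology (HomogeneousIdeal.irrelevant 𝒜) J k N).deg n)))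
    (i : ℕ) (M : GrMod 𝒜) (hM : Module.Finite R M)
    (hfin : ∀ j < i, Module.Finite R
      (localCohomology (HomogeneousIdeal.irrelevant 𝒜) J j M)) :
    (AsymptoticallyStable fun n : ℤ => associatedPrimes R₀
      ((localCohomology (HomogeneousIdeal.irrelevant 𝒜) J i M).deg n)) ∧
    ∀ n : ℤ, HasFiniteAssQuotients R₀
      ((localCohomology (HomogeneousIdeal.irrelevant 𝒜) J i M).deg n) := by
  set I := HomogeneousIdeal.irrelevant 𝒜
  induction i generalizing M with
  | zero =>
    have := finite_localCohomology_zero I J M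
    obtain ⟨n₀, h₀⟩ := (localCohomology I J 0 M).exists_deg_eq_bot
    have hempty : ∀ n ≤ n₀, associatedPrimes R₀ ((localCohomology I J 0 M).deg n) = ∅ := by
      intro n hn
      have := Submodule.subsingleton_iff_eq_bot.2 (h₀ n hn)
      exact associatedPrimes.eq_empty_of_subsingleton
    refine ⟨⟨n₀, fun n hn => (hempty n hn).trans (hempty n₀ le_rfl).symm⟩, fun n => ?_⟩
    have := finite_deg (localCohomology I J 0 M) h𝒜 n
    exact hasFiniteAssQuotients_of_finite _ _
  | succ i ih =>
    let X := torsionFree I J M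
    have hX := finite_localCohomology_torsionFree I J M (i + 1) hfin
    obtain ⟨e⟩ := nonempty_localCohomology_torsionFree_iso I J M i
    obtain ⟨a, ha, hreg⟩ := X.exists_regular h𝒜 J (torsion_torsionFree I J M)
    let N := X.quot _ (range_homogeneous (X.mulHom ha))
    have hN : Module.Finite R N := Module.Finite.of_surjective
      (Submodule.mkQ (LinearMap.range (X.mulHom ha).toLin)) (Submodule.mkQ_surjective _)
    -- `H^j(N)` lies between `H^j(X)` and `H^{j+1}(X)(-1)`, both finite because `j + 1 < i + 1`.
    obtain ⟨⟨n₁, hstab⟩, hNQ⟩ := ih N hN fun j hj => by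
      obtain ⟨g, δ, -, hgδ, -⟩ := localCohomology_exact_of_regular I J X ha hreg j
      have h₁ : IsNoetherian R (localCohomology I J j X) := by
        have := hX j (by omega)
        exact isNoetherian_of_isNoetherianRing_of_finite _ _
      have h₂ : IsNoetherian R ((localCohomology I J (j + 1) X).shift (-1)) := by
        have : Module.Finite R (localCohomology I J (j + 1) X) := hX (j + 1) (by omega)
        exact isNoetherian_of_isNoetherianRing_of_finite R (localCohomology I J (j + 1) X)
      have := isNoetherian_of_range_eq_ker g.toLin δ.toLin (LinearMap.exact_iff.1 hgδ).symm
      infer_instance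
    obtain ⟨g, δ, f, hgδ, hδf⟩ := localCohomology_exact_of_regular I J X ha hreg i
    have hfX : Module.Finite R (localCohomology I J i X) := hX i (by omega)
    obtain ⟨n₂, hn₂⟩ := (localCohomology I J i X).exists_deg_eq_bot
    have hfinite (n : ℤ) := finite_deg (localCohomology I J i X) h𝒜 n
    have hQ : ∀ n, HasFiniteAssQuotients R₀ ((localCohomology I J (i + 1) X).deg n) := by
      rcases hcond with hcond | hcond
      -- Condition (a): descend from the degrees where the component vanishes, using that `H^i(X)_n`
      -- is finite over `R₀`.
      · have hstep : ∀ n, HasFiniteAssQuotients R₀ ((localCohomology I J (i + 1) X).deg n) →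
            HasFiniteAssQuotients R₀ ((localCohomology I J (i + 1) X).deg (n + -1)) := fun n hn =>
          (hNQ n).of_exact (exact_degMap hgδ n) (exact_degMap hδf n) hn
        obtain ⟨n₀, h₀⟩ := hcond X inferInstance (i + 1)
        have hbot : ∀ n ≥ n₀, HasFiniteAssQuotients R₀ ((localCohomology I J (i + 1) X).deg n) := by
          intro n hn
          have := Submodule.subsingleton_iff_eq_bot.2 (h₀ n hn)
          exact hasFiniteAssQuotients_of_finite _ _
        intro n
        rcases le_total n₀ n with hn | hn
        · exact hbot n hn
        · induction n, hn using Int.leInductionDown with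
          | base => exact hbot n₀ le_rfl
          | pred n _ ih => exact hstep n ih
      · intro n
        have := hcond X inferInstance (i + 1) n
        exact hasFiniteAssQuotients_of_finite _ _
    have hstable : AsymptoticallyStable fun n : ℤ =>
        associatedPrimes R₀ ((localCohomology I J (i + 1) X).deg n) := by
      have hex : ∀ n ≤ min n₁ n₂,
          associatedPrimes R₀ ((localCohomology I J i N).deg n₁) ⊆
            associatedPrimes R₀ ((localCohomology I J (i + 1) X).deg (n - 1)) ∧
          associatedPrimes R₀ ((localCohomology I J (i + 1) X).deg (n - 1)) ⊆
            associatedPrimes R₀ ((localCohomology I J i N).deg n₁) ∪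
              associatedPrimes R₀ ((localCohomology I J (i + 1) X).deg n) := by
        intro n hn
        have hs : associatedPrimes R₀ ((localCohomology I J i N).deg n) =
            associatedPrimes R₀ ((localCohomology I J i N).deg n₁) :=
          hstab n (hn.trans (min_le_left _ _))
        rw [← hs]
        have := Submodule.subsingleton_iff_eq_bot.2 (hn₂ n (hn.trans (min_le_right _ _)))
        -- In these degrees `H^i(X)_n` vanishes, so the connecting map is injective.
        have hinj : Function.Injective (Hom.degMap δ n) :=
          (injective_iff_map_eq_zero _).2 fun y hy => by
            obtain ⟨x, rfl⟩ := (exact_degMap hgδ n y).1 hy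
            rw [Subsingleton.elim x 0, map_zero]
        exact ⟨associatedPrimes.subset_of_injective hinj,
          associatedPrimes.subset_union_of_exact hinj (exact_degMap hδf n)⟩
      refine asymptoticallyStable_of_subset (min n₁ n₂)
        (fun n => (hQ n).finite_associatedPrimes) (fun n hn => ?_) (fun n hn => (hex n hn).2)
      -- The connecting map lowers the degree by one, so the lower bound in degree `n` is read off
      -- at `n + 1`; hence the strict inequality `n < min n₁ n₂`.
      have := (hex (n + 1) (by omega)).1
      rwa [add_sub_cancel_right] at this
    have hiso (n : ℤ) := isoDegEquiv e n
    refine ⟨?_, fun n => (hQ n).of_equiv (hiso n).symm⟩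
    obtain ⟨n₀, h₀⟩ := hstable
    refine ⟨n₀, fun n hn => ?_⟩
    change associatedPrimes R₀ _ = associatedPrimes R₀ _
    rw [LinearEquiv.AssociatedPrimes.eq (hiso n), LinearEquiv.AssociatedPrimes.eq (hiso n₀)]
    exact h₀ n hn

end

end GradedLC

theorem theorem4p1 {R₀ R : Type u} [CommRing R₀] [CommRing R] [Algebra R₀ R]
    [IsNoetherianRing R₀] [IsNoetherianRing R]
    [IsLocalRing R₀] [Infinite (IsLocalRing.ResidueField R₀)]
    (𝒜 : ℕ → Submodule R₀ R) [GradedAlgebra 𝒜] (h𝒜 : GradedLC.IsStandardGraded 𝒜)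
    (J : HomogeneousIdeal 𝒜)
    (M : GradedLC.GrMod 𝒜) (hM : Module.Finite R M) (i : ℕ)
    (hfin : ∀ j < i, Module.Finite R
      (GradedLC.localCohomology (HomogeneousIdeal.irrelevant 𝒜) J j M))
    (hcond :
      (∀ N : GradedLC.GrMod 𝒜, Module.Finite R N → ∀ k : ℕ, ∃ n₀ : ℤ, ∀ n ≥ n₀,
        (GradedLC.localCohomology (HomogeneousIdeal.irrelevant 𝒜) J k N).deg n = ⊥) ∨
      (∀ N : GradedLC.GrMod 𝒜, Module.Finite R N → ∀ (k : ℕ) (n : ℤ), Module.Finite R₀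
        ((GradedLC.localCohomology (HomogeneousIdeal.irrelevant 𝒜) J k N).deg n))) :
    GradedLC.AsymptoticallyStable fun n : ℤ => associatedPrimes R₀
      ((GradedLC.localCohomology (HomogeneousIdeal.irrelevant 𝒜) J i M).deg n) :=
  (GradedLC.asymptoticallyStable_and_hasFiniteAssQuotients h𝒜 J hcond i M hM hfin).1
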